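/- **Setting (stochastic linear bandit).** In each round $t=1,2,\dots$ a learner observes a (possibly random) action set $\mathcal A_t$, plays $a_t\in\mathcal A_t$ and receives $r_t=\phi(a_t)^\top\theta^*+\epsilon_t$, where $\phi$ is a known feature map into $\mathbb R^d$, $d\ge1$. Write $\mathcal A=\bigcup_t\mathcal A_t$, and let $\mathcal H_t$ be the $\sigma$-algebra generated by $(a_1,r_1,\dots,a_t,r_t,a_{t+1})$. Let $\sigma,B,L,C>0$ and assume 1. $\mathbb E[\epsilon_t\mid\mathcal H_{t-1}]=0$ and $\mathbb E[e^{\lambda\epsilon_t}\mid\mathcal H_{t-1}]\le e^{\lambda^2\sigma^2/2}$ for all $\lambda\in\mathbb R$ and $t\ge1$; 2. $\|\theta^*\|_2\le B$; 3. $\|\phi(a)\|_2\le L$ for all $a\in\mathcal A$; 4. $\phi(a)^\top\theta^*\in[-C,C]$ for all $a\in\mathcal A$. The cumulative regret is $\Delta_{1:T}=\sum_{t=1}^T\big(\sup_{a\in\mathcal A_t}\phi(a)^\top\theta^*-\phi(a_t)^\top\theta^*\big)$. **Algorithms.** Let $\Phi_t\in\mathbb R^{t\times d}$ have rows $\phi(a_1)^\top,\dots,\phi(a_t)^\top$,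 and let $\boldsymbol r_t=(r_1,\dots,r_t)^\top$. For $\theta_0\in\mathbb R^d$, $\sigma_0>0$, use the mixture distributions $P_t=\mathcal N(\mu_t,T_t)$ with $\mu_t=\Phi_t\theta_0$, $T_t=\sigma_0^2\Phi_t\Phi_t^\top$. For $\delta\in(0,1/2]$ and $\alpha>0$ put $$R_{\mathrm{MM},t}^2=(\mu_t-\boldsymbol r_t)^\top\Big(1+\frac{T_t}{\sigma^2}\Big)^{-1}(\mu_t-\boldsymbol r_t)+\sigma^2\ln\det\Big(1+\frac{T_t}{\sigma^2}\Big)+2\sigma^2\ln\frac1\delta,$$ $$\Theta_t=\{\theta\in\mathbb R^d:\ \|\Phi_t\theta-\boldsymbol r_t\|_2\le R_{\mathrm{MM},t},\ \|\theta\|_2\le B\},\qquad V_t=\Phi_t^\top\Phi_t+\alpha 1,\qquad \widehat\theta_{\alpha,t}=V_t^{-1}\Phi_t^\top\boldsymbol r_t,$$ $$R_{\mathrm{AMM},t}^2=R_{\mathrm{MM},t}^2+\alpha B^2-\boldsymbol r_t^\top\boldsymbol r_t+\boldsymbol r_t^\top\Phi_tV_t^{-1}\Phi_t^\top\boldsymbol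 r_t$$ (if the last right-hand side is negative, $R_{\mathrm{AMM},t}:=0$). CMM-UCB plays some $a_{t+1}\in\arg\max_{a\in\mathcal A_{t+1}}\max_{\theta\in\Theta_t}\phi(a)^\top\theta$ for every $t\ge0$ (any action of $\mathcal A_{t+1}$ if $\Theta_t=\emptyset$). AMM-UCB with parameter $\alpha$ plays some $a_{t+1}\in\arg\max_{a\in\mathcal A_{t+1}}\big\{\phi(a)^\top\widehat\theta_{\alpha,t}+R_{\mathrm{AMM},t}\sqrt{\phi(a)^\top V_t^{-1}\phi(a)}\big\}$ for every $t\ge0$. **Theorem.** Under assumptions 1–4, for every $\theta_0\in\mathbb R^d$, $\sigma_0>0$, $\delta\in(0,1/2]$ and $\alpha>0$, if the actions are selected by CMM-UCB or by AMM-UCB with parameter $\alpha$, then with probability at least $1-2\delta$, simultaneously for all $T\ge1$, $$\Delta_{1:T}\le\frac{2}{\sqrt{\ln2}}\max\{C,U_{\mathrm{AMM},T-1}\}\sqrt{dT\ln\Big(1+\frac{L^2T}{\alpha d}\Big)},$$ where $$\begin{aligned}U_{\mathrm{AMM},T-1}^2={}&\sigma^2d+\frac{\sigma^2}{\sigma_0^2}\|\theta^*-\theta_0\|_2^2+\sigma^2d\ln\Big(1+\frac{(T-1)\sigma_0^2L^2}{\sigma^2d}\Big)+\alpha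 B^2+4\sigma^2\ln\frac1\delta\\&+\sigma^2d\ln\Big(1+\frac{(T-1)L^2}{\alpha d}\Big)+2\sqrt\alpha\,\|\theta^*\|_2\sqrt{\sigma^2d\ln\Big(1+\frac{(T-1)L^2}{\alpha d}\Big)+2\sigma^2\ln\frac1\delta}.\end{aligned}$$ Moreover, this bound is $\mathcal O(d\sqrt T\ln T)$: for fixed $\sigma,\sigma_0,B,L,C,\alpha,\delta$ and $D$ there is a constant $K$, depending only on these, such that the right-hand side of the regret bound is at most $K\,d\sqrt T\ln T$ for all $d\ge1$, all $T\ge2$ and all $\theta^*,\theta_0\in\mathbb R^d$ with $\|\theta^*\|_2\le B$ and $\|\theta^*-\theta_0\|_2\le D$. -/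

import Mathlib

open MeasureTheory
open scoped Matrix

noncomputable section

namespace LinearBandit

/-! Rounds are numbered from `0`: index `k` stands for round `k + 1`.  So `a k`, `r k` are the
action and the reward of round `k + 1`, objects with subscript `t` are built from the first `t`
rounds, and the action `a t` is selected by means of the confidence set `Θ_t`. -/

/-- `Φ_t`, the `t × d` matrix whose rows are the features of the first `t` actions. -/
def featureMatrix {𝒜 : Type*} {d : ℕ} (φ : 𝒜 → EuclideanSpace ℝ (Fin d)) (x : ℕ → 𝒜) (t : ℕ) :
    Matrix (Fin t) (Fin d) ℝ :=
  Matrix.of fun i j => φ (x i) j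

/-- `r_t`, the vector of the first `t` rewards. -/
def rewardVector (y : ℕ → ℝ) (t : ℕ) : Fin t → ℝ := fun i => y i

/-- The squared radius `R_{MM,t}²` for the Gaussian mixture distribution `N(m, S)` on `ℝ^t`. -/
def mmRadiusSq (σ δ : ℝ) {t : ℕ} (m : Fin t → ℝ) (S : Matrix (Fin t) (Fin t) ℝ)
    (y : Fin t → ℝ) : ℝ :=
  (m - y) ⬝ᵥ ((1 + (1 / σ ^ 2) • S)⁻¹ *ᵥ (m - y))
    + σ ^ 2 * Real.log (1 + (1 / σ ^ 2) • S).det + 2 * σ ^ 2 * Real.log (1 / δ)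

/-- `R_{MM,t}²` for the mixture distributions `P_t = N(Φ_t θ₀, σ₀² Φ_t Φ_tᵀ)`. -/
def linRadiusSq (σ σ₀ δ : ℝ) {d t : ℕ} (θ₀ : EuclideanSpace ℝ (Fin d))
    (X : Matrix (Fin t) (Fin d) ℝ) (y : Fin t → ℝ) : ℝ :=
  mmRadiusSq σ δ (X *ᵥ θ₀.ofLp) (σ₀ ^ 2 • (X * Xᵀ)) y

/-- The confidence set `Θ_t = {θ : ‖Φ_t θ - r_t‖₂ ≤ R and ‖θ‖₂ ≤ B}`. -/
def confSet {d t : ℕ} (R B : ℝ) (X : Matrix (Fin t) (Fin d) ℝ) (y : Fin t → ℝ) :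
    Set (EuclideanSpace ℝ (Fin d)) :=
  {θ | ‖WithLp.toLp 2 (X *ᵥ θ.ofLp - y)‖ ≤ R ∧ ‖θ‖ ≤ B}

/-- `UCB_Θ` at an action with feature vector `v`: the maximum of `vᵀθ` over `θ ∈ Θ`.  (The sets
`confSet` are compact, so the supremum is a maximum as soon as the set is nonempty.) -/
def ucb {d : ℕ} (Θ : Set (EuclideanSpace ℝ (Fin d))) (v : EuclideanSpace ℝ (Fin d)) : ℝ :=
  sSup ((fun θ => inner ℝ v θ) '' Θ)

/-- The regularised Gram matrix `Φ_tᵀ Φ_t + α 1`. -/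
def gram (α : ℝ) {d t : ℕ} (X : Matrix (Fin t) (Fin d) ℝ) : Matrix (Fin d) (Fin d) ℝ :=
  Xᵀ * X + α • (1 : Matrix (Fin d) (Fin d) ℝ)

/-- The ridge estimate `θ̂_{α,t} = (Φ_tᵀ Φ_t + α 1)⁻¹ Φ_tᵀ r_t`. -/
def ridge (α : ℝ) {d t : ℕ} (X : Matrix (Fin t) (Fin d) ℝ) (y : Fin t → ℝ) : Fin d → ℝ :=
  (gram α X)⁻¹ *ᵥ (Xᵀ *ᵥ y)

/-- The squared radius `R_{AMM,t}²`, as a function of `Rsq = R_{MM,t}²`. -/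
def ammRadiusSq (Rsq α B : ℝ) {d t : ℕ} (X : Matrix (Fin t) (Fin d) ℝ) (y : Fin t → ℝ) : ℝ :=
  Rsq + α * B ^ 2 - y ⬝ᵥ y + y ⬝ᵥ (X *ᵥ ((gram α X)⁻¹ *ᵥ (Xᵀ *ᵥ y)))

/-- The analytic upper confidence bound `AUCB_{Θ_t}` at an action with feature vector `v`. -/
def aucb (Rsq α B : ℝ) {d t : ℕ} (X : Matrix (Fin t) (Fin d) ℝ) (y : Fin t → ℝ)
    (v : EuclideanSpace ℝ (Fin d)) : ℝ :=
  v.ofLp ⬝ᵥ ridge α X y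
    + √(ammRadiusSq Rsq α B X y) * √(v.ofLp ⬝ᵥ ((gram α X)⁻¹ *ᵥ v.ofLp))

/-- `x 0, x 1, …` are actions selected by CMM-UCB from the action sets `S 0, S 1, …` when the
observed rewards are `y 0, y 1, …`: every action maximises `UCB_{Θ_t}` over the current set. -/
def IsCMMRun {𝒜 : Type*} {d : ℕ} (σ σ₀ δ B : ℝ) (θ₀ : EuclideanSpace ℝ (Fin d))
    (φ : 𝒜 → EuclideanSpace ℝ (Fin d)) (S : ℕ → Set 𝒜) (x : ℕ → 𝒜) (y : ℕ → ℝ) : Prop :=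
  ∀ t, x t ∈ S t ∧ ∀ b ∈ S t,
    let X := featureMatrix φ x t
    let Y := rewardVector y t
    let Θ := confSet √(linRadiusSq σ σ₀ δ θ₀ X Y) B X Y
    ucb Θ (φ b) ≤ ucb Θ (φ (x t))

/-- The same for AMM-UCB with parameter `α`: every action maximises `AUCB_{Θ_t}`. -/
def IsAMMRun {𝒜 : Type*} {d : ℕ} (σ σ₀ δ B α : ℝ) (θ₀ : EuclideanSpace ℝ (Fin d))
    (φ : 𝒜 → EuclideanSpace ℝ (Fin d)) (S : ℕ → Set 𝒜) (x : ℕ → 𝒜) (y : ℕ → ℝ) : Prop :=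
  ∀ t, x t ∈ S t ∧ ∀ b ∈ S t,
    let X := featureMatrix φ x t
    let Y := rewardVector y t
    let Rsq := linRadiusSq σ σ₀ δ θ₀ X Y
    aucb Rsq α B X Y (φ b) ≤ aucb Rsq α B X Y (φ (x t))

/-- `Δ_{1:T}`: the sum over the first `T` rounds of the largest expected reward available in the
round minus the expected reward of the action played.  (The supremum is the value at an optimal
action whenever there is one.) -/
def cumRegret {𝒜 : Type*} {d : ℕ} (θs : EuclideanSpace ℝ (Fin d))
    (φ : 𝒜 → EuclideanSpace ℝ (Fin d)) (S : ℕ → Set 𝒜) (x : ℕ → 𝒜) (T : ℕ) : ℝ :=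
  ∑ t ∈ Finset.range T,
    (sSup ((fun b => inner ℝ (φ b) θs) '' S t) - inner ℝ (φ (x t)) θs)

/-- `ℋ_t`: the σ-algebra generated by the first `t + 1` actions and the first `t` rewards. -/
@[reducible]
def history {Ω 𝒜 : Type*} [m𝒜 : MeasurableSpace 𝒜] (a : ℕ → Ω → 𝒜) (r : ℕ → Ω → ℝ) (t : ℕ) :
    MeasurableSpace Ω :=
  (⨆ i ∈ Finset.range (t + 1), MeasurableSpace.comap (a i) m𝒜) ⊔
    ⨆ i ∈ Finset.range t, MeasurableSpace.comap (r i) (borel ℝ)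

/-- The noise `ε = r - φ(a)ᵀθ*` of the round with index `t`. -/
def noise {Ω 𝒜 : Type*} {d : ℕ} (θs : EuclideanSpace ℝ (Fin d))
    (φ : 𝒜 → EuclideanSpace ℝ (Fin d)) (a : ℕ → Ω → 𝒜) (r : ℕ → Ω → ℝ) (t : ℕ) (ω : Ω) : ℝ :=
  r t ω - inner ℝ (φ (a t ω)) θs

/-- The variable `ε` is, conditionally on `m`, centred and `σ`-sub-Gaussian.  The integrability
clauses make the conditional expectations meaningful. -/
def CondSubGaussian {Ω : Type*} {m₀ : MeasurableSpace Ω} (μ : Measure Ω) (m : MeasurableSpace Ω)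
    (σ : ℝ) (ε : Ω → ℝ) : Prop :=
  Integrable ε μ ∧ μ[ε|m] =ᵐ[μ] 0 ∧
    ∀ l : ℝ, Integrable (fun ω => Real.exp (l * ε ω)) μ ∧
      μ[fun ω => Real.exp (l * ε ω)|m] ≤ᵐ[μ] fun _ => Real.exp (l ^ 2 * σ ^ 2 / 2)

/-- The quantity `U_{AMM,t}²`; here `D = ‖θ* - θ₀‖₂` and `N = ‖θ*‖₂`. -/
def uAMMSq (σ σ₀ B L α δ D N : ℝ) (d : ℕ) (t : ℝ) : ℝ :=
  σ ^ 2 * d + σ ^ 2 / σ₀ ^ 2 * D ^ 2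
    + σ ^ 2 * d * Real.log (1 + t * σ₀ ^ 2 * L ^ 2 / (σ ^ 2 * d))
    + α * B ^ 2 + 4 * σ ^ 2 * Real.log (1 / δ)
    + σ ^ 2 * d * Real.log (1 + t * L ^ 2 / (α * d))
    + 2 * √α * N *
      √(σ ^ 2 * d * Real.log (1 + t * L ^ 2 / (α * d)) + 2 * σ ^ 2 * Real.log (1 / δ))

/-- The regret bound `(2/√(ln 2)) max{C, U_{AMM,T-1}} √(d T ln(1 + L² T / (α d)))`. -/
def regretBound (σ σ₀ B L C α δ D N : ℝ) (d T : ℕ) : ℝ :=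
  2 / √(Real.log 2) * max C √(uAMMSq σ σ₀ B L α δ D N d ((T : ℝ) - 1))
    * √(d * T * Real.log (1 + L ^ 2 * T / (α * d)))

end LinearBandit

end

/-! Compare θ with θ* by the likelihood ratio that Gaussian noise of variance σ² would give.
Conditional sub-Gaussianity makes this ratio a supermartingale, and so is its average over a
Gaussian prior on θ. By Ville's inequality the average stays below 1/δ at all times simultaneously,
except with probability at most δ (`measure_exists_mixture_ge`). The average is a Gaussian integral:
completing the square evaluates it and turns "below 1/δ" into an upper bound on the squared norm of
the noise e by a minimal ridge loss plus a log-determinant (`noise_sq_le_of_mixture_lt`).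

Two priors are used, which accounts for the 2δ. Mean θ₀ and covariance σ₀²·1 give exactly θ* ∈ Θ_t.
Mean θ* and covariance (σ²/α)·1 give a self-normalised bound on e with regularisation α. The latter
controls the radius: R_MM² is at most ‖e‖² plus explicit terms, and the minimal ridge loss of the
rewards, subtracted in R_AMM², is at least ‖e‖² minus explicit terms, so ‖e‖² cancels
(`ammRadiusSq_le_uAMMSq`).

The rest is deterministic. Θ_t lies in an ellipsoid around the ridge estimate, so both upper
confidence bounds dominate the true value and, at the action played, exceed it by at most 2 R_AMM
√w, with w the `width`. Capping each regret at 2C, Cauchy–Schwarz and the elliptic potential lemma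
finish (`cumRegret_le_regretBound`). -/

namespace LinearBandit

/-! ### Ridge regression and regularised Gram matrices. -/

section LinearAlgebra

variable {d t : ℕ}

/-- The minimum over `v` of the ridge loss `‖X v - w‖² + α ‖v‖²`. -/
noncomputable def ridgeMin (α : ℝ) (X : Matrix (Fin t) (Fin d) ℝ) (w : Fin t → ℝ) : ℝ :=
  w ⬝ᵥ w - w ⬝ᵥ (X *ᵥ ((gram α X)⁻¹ *ᵥ (Xᵀ *ᵥ w)))

theorem dotProduct_self_nonneg' (v : Fin d → ℝ) : 0 ≤ v ⬝ᵥ v :=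
  Finset.sum_nonneg fun i _ => mul_self_nonneg (v i)

theorem transpose_mulVec_dotProduct (X : Matrix (Fin t) (Fin d) ℝ) (w : Fin t → ℝ)
    (v : Fin d → ℝ) : (Xᵀ *ᵥ w) ⬝ᵥ v = w ⬝ᵥ (X *ᵥ v) := by
  rw [Matrix.mulVec_transpose, Matrix.dotProduct_mulVec]

theorem gram_mulVec (α : ℝ) (X : Matrix (Fin t) (Fin d) ℝ) (v : Fin d → ℝ) :
    gram α X *ᵥ v = Xᵀ *ᵥ (X *ᵥ v) + α • v := by
  rw [gram, Matrix.add_mulVec, Matrix.mulVec_mulVec, Matrix.smul_mulVec, Matrix.one_mulVec]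

theorem gram_isHermitian (α : ℝ) (X : Matrix (Fin t) (Fin d) ℝ) : (gram α X).IsHermitian := by
  rw [Matrix.IsHermitian, Matrix.conjTranspose_eq_transpose_of_trivial, gram]
  simp

theorem dotProduct_gram_mulVec (α : ℝ) (X : Matrix (Fin t) (Fin d) ℝ) (u v : Fin d → ℝ) :
    u ⬝ᵥ (gram α X *ᵥ v) = (X *ᵥ u) ⬝ᵥ (X *ᵥ v) + α * (u ⬝ᵥ v) := by
  rw [gram_mulVec, dotProduct_add, dotProduct_smul, smul_eq_mul, dotProduct_comm u,
    transpose_mulVec_dotProduct, dotProduct_comm (X *ᵥ v)]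

theorem gram_posDef {α : ℝ} (hα : 0 < α) (X : Matrix (Fin t) (Fin d) ℝ) :
    (gram α X).PosDef := by
  refine .of_dotProduct_mulVec_pos (gram_isHermitian α X) fun v hv => ?_
  rw [star_trivial, dotProduct_gram_mulVec]
  have h1 := dotProduct_self_nonneg' (X *ᵥ v)
  have h2 : 0 < v ⬝ᵥ v :=
    lt_of_le_of_ne (dotProduct_self_nonneg' v) fun h => hv (dotProduct_self_eq_zero.1 h.symm)
  positivity

theorem gram_isUnit_det {α : ℝ} (hα : 0 < α) (X : Matrix (Fin t) (Fin d) ℝ) :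
    IsUnit (gram α X).det :=
  (gram_posDef hα X).det_pos.ne'.isUnit

theorem gram_mulVec_inv {α : ℝ} (hα : 0 < α) (X : Matrix (Fin t) (Fin d) ℝ) (v : Fin d → ℝ) :
    gram α X *ᵥ ((gram α X)⁻¹ *ᵥ v) = v := by
  rw [Matrix.mulVec_mulVec, Matrix.mul_nonsing_inv _ (gram_isUnit_det hα X), Matrix.one_mulVec]

theorem gram_comm_dotProduct (α : ℝ) (X : Matrix (Fin t) (Fin d) ℝ) (u v : Fin d → ℝ) :
    u ⬝ᵥ (gram α X *ᵥ v) = v ⬝ᵥ (gram α X *ᵥ u) := by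
  rw [dotProduct_gram_mulVec, dotProduct_gram_mulVec, dotProduct_comm u, dotProduct_comm (X *ᵥ u)]

theorem dotProduct_gram_mulVec_self_ge {α : ℝ} (X : Matrix (Fin t) (Fin d) ℝ)
    (v : Fin d → ℝ) : α * (v ⬝ᵥ v) ≤ v ⬝ᵥ (gram α X *ᵥ v) := by
  rw [dotProduct_gram_mulVec]
  linarith [dotProduct_self_nonneg' (X *ᵥ v)]

theorem dotProduct_gram_mulVec_self_nonneg {α : ℝ} (hα : 0 < α) (X : Matrix (Fin t) (Fin d) ℝ)
    (v : Fin d → ℝ) : 0 ≤ v ⬝ᵥ (gram α X *ᵥ v) :=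
  (mul_nonneg hα.le (dotProduct_self_nonneg' v)).trans (dotProduct_gram_mulVec_self_ge X v)

/-- Completing the square in the ridge loss. -/
theorem ridge_loss_eq {α : ℝ} (hα : 0 < α) (X : Matrix (Fin t) (Fin d) ℝ) (w : Fin t → ℝ)
    (v : Fin d → ℝ) :
    (X *ᵥ v - w) ⬝ᵥ (X *ᵥ v - w) + α * (v ⬝ᵥ v)
      = ridgeMin α X w + (v - ridge α X w) ⬝ᵥ (gram α X *ᵥ (v - ridge α X w)) := by
  have h1 : ∀ u, u ⬝ᵥ (gram α X *ᵥ ridge α X w) = w ⬝ᵥ (X *ᵥ u) := fun u => by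
    rw [ridge, gram_mulVec_inv hα, dotProduct_comm, transpose_mulVec_dotProduct]
  have h2 : ridgeMin α X w = w ⬝ᵥ w - w ⬝ᵥ (X *ᵥ ridge α X w) := rfl
  have h3 := dotProduct_gram_mulVec α X v v
  rw [h2]
  simp only [Matrix.mulVec_sub, sub_dotProduct, dotProduct_sub]
  rw [gram_comm_dotProduct α X (ridge α X w) v, h1, h1, h3]
  rw [dotProduct_comm (X *ᵥ v) w]
  ring

theorem ridgeMin_le {α : ℝ} (hα : 0 < α) (X : Matrix (Fin t) (Fin d) ℝ) (w : Fin t → ℝ)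
    (v : Fin d → ℝ) :
    ridgeMin α X w ≤ (X *ᵥ v - w) ⬝ᵥ (X *ᵥ v - w) + α * (v ⬝ᵥ v) := by
  rw [ridge_loss_eq hα]
  linarith [dotProduct_gram_mulVec_self_nonneg hα X (v - ridge α X w)]

theorem ridgeMin_neg (α : ℝ) (X : Matrix (Fin t) (Fin d) ℝ) (w : Fin t → ℝ) :
    ridgeMin α X (-w) = ridgeMin α X w := by
  simp [ridgeMin, Matrix.mulVec_neg]

/-- The Woodbury identity, as an identity of quadratic forms. -/
theorem dotProduct_inv_one_add_mulVec {α : ℝ} (hα : 0 < α) (X : Matrix (Fin t) (Fin d) ℝ)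
    (w : Fin t → ℝ) :
    w ⬝ᵥ ((1 + α⁻¹ • (X * Xᵀ))⁻¹ *ᵥ w) = ridgeMin α X w := by
  have hV := Matrix.mul_nonsing_inv _ (gram_isUnit_det hα X)
  -- With V the Gram matrix, the inverse is 1 - X V⁻¹ Xᵀ; this is checked by expanding X V V⁻¹ Xᵀ in
  -- two ways.
  have key : (1 + α⁻¹ • (X * Xᵀ)) * (1 - X * (gram α X)⁻¹ * Xᵀ) = 1 := by
    have h : X * gram α X * (gram α X)⁻¹ * Xᵀ = X * Xᵀ := by
      rw [Matrix.mul_assoc X, hV, Matrix.mul_one]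
    have h' : X * gram α X * (gram α X)⁻¹ * Xᵀ
        = X * Xᵀ * X * (gram α X)⁻¹ * Xᵀ + α • (X * (gram α X)⁻¹ * Xᵀ) := by
      conv_lhs => rw [show X * gram α X = X * Xᵀ * X + α • X by
        rw [gram, Matrix.mul_add, Matrix.mul_smul, Matrix.mul_one, Matrix.mul_assoc]]
      simp only [Matrix.add_mul, Matrix.smul_mul]
    have h'' : X * Xᵀ * (X * (gram α X)⁻¹ * Xᵀ)
        = X * Xᵀ - α • (X * (gram α X)⁻¹ * Xᵀ) := by
      have h3 := h.symm.trans h'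
      rw [eq_sub_iff_add_eq]
      simp only [Matrix.mul_assoc] at h3 ⊢
      exact h3.symm
    rw [Matrix.add_mul, Matrix.one_mul, Matrix.mul_sub, Matrix.mul_one, Matrix.smul_mul, h'',
      smul_sub, smul_smul, inv_mul_cancel₀ hα.ne', one_smul]
    abel
  rw [Matrix.inv_eq_right_inv key, Matrix.sub_mulVec, Matrix.one_mulVec, dotProduct_sub, ridgeMin]
  simp only [Matrix.mulVec_mulVec, Matrix.mul_assoc]

/-- Cauchy–Schwarz for the norms given by a regularised Gram matrix and by its inverse. -/
theorem dotProduct_sq_le_gram {α : ℝ} (hα : 0 < α) (X : Matrix (Fin t) (Fin d) ℝ)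
    (u v : Fin d → ℝ) :
    (v ⬝ᵥ u) ^ 2 ≤ (v ⬝ᵥ ((gram α X)⁻¹ *ᵥ v)) * (u ⬝ᵥ (gram α X *ᵥ u)) := by
  set z := (gram α X)⁻¹ *ᵥ v with hz
  have hzv : gram α X *ᵥ z = v := gram_mulVec_inv hα X v
  -- The quadratic in s is the squared V-norm of u - s V⁻¹ v, so its discriminant is nonpositive.
  have h : ∀ s : ℝ, 0 ≤ (v ⬝ᵥ z) * (s * s) + (-2 * (v ⬝ᵥ u)) * s + u ⬝ᵥ (gram α X *ᵥ u) := by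
    intro s
    have h0 := dotProduct_gram_mulVec_self_nonneg hα X (u - s • z)
    rw [Matrix.mulVec_sub, Matrix.mulVec_smul, hzv, sub_dotProduct, dotProduct_sub,
      dotProduct_sub, gram_comm_dotProduct α X (s • z) u, Matrix.mulVec_smul, hzv] at h0
    simp only [smul_dotProduct, dotProduct_smul, smul_eq_mul] at h0
    rw [dotProduct_comm u v, dotProduct_comm z v] at h0
    linarith
  have := discrim_le_zero h
  rw [discrim] at this
  linarith

theorem dotProduct_le_gram {α : ℝ} (hα : 0 < α) (X : Matrix (Fin t) (Fin d) ℝ)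
    {u v : Fin d → ℝ} {b : ℝ} (hu : u ⬝ᵥ (gram α X *ᵥ u) ≤ b) :
    |v ⬝ᵥ u| ≤ √b * √(v ⬝ᵥ ((gram α X)⁻¹ *ᵥ v)) := by
  have h0 := dotProduct_gram_mulVec_self_nonneg hα X u
  have h1 : 0 ≤ v ⬝ᵥ ((gram α X)⁻¹ *ᵥ v) := by
    have := dotProduct_gram_mulVec_self_nonneg hα X ((gram α X)⁻¹ *ᵥ v)
    rwa [gram_mulVec_inv hα, dotProduct_comm] at this
  rw [← Real.sqrt_mul (h0.trans hu)]
  apply Real.abs_le_sqrt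
  refine (dotProduct_sq_le_gram hα X u v).trans ?_
  rw [mul_comm]
  gcongr

/-- Arithmetic–geometric mean inequality for the eigenvalues of a positive definite matrix. -/
theorem log_det_le_of_trace_le {d : ℕ} {A : Matrix (Fin d) (Fin d) ℝ} (hA : A.PosDef) {c : ℝ}
    (hc : 0 < c) (htr : A.trace ≤ d * c) : Real.log A.det ≤ d * Real.log c := by
  have h1 : A.det = ∏ i, hA.1.eigenvalues i := by
    simpa using hA.1.det_eq_prod_eigenvalues
  have h2 : A.trace = ∑ i, hA.1.eigenvalues i := by
    simpa using hA.1.trace_eq_sum_eigenvalues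
  have h3 : ∀ i, Real.log (hA.1.eigenvalues i) ≤ Real.log c + (hA.1.eigenvalues i / c - 1) := by
    intro i
    have hp := hA.eigenvalues_pos i
    have := Real.log_le_sub_one_of_pos (div_pos hp hc)
    rw [Real.log_div hp.ne' hc.ne'] at this
    linarith
  rw [h1, Real.log_prod (fun i _ => (hA.eigenvalues_pos i).ne')]
  refine (Finset.sum_le_sum fun i _ => h3 i).trans ?_
  rw [Finset.sum_add_distrib, Finset.sum_sub_distrib, ← Finset.sum_div, ← h2]
  have : A.trace / c ≤ d := by rw [div_le_iff₀ hc]; exact htr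
  simp
  linarith

/-- The trace of Xᵀ X is the sum of the squared row norms, hence at most t M; the mean eigenvalue of
the normalised Gram matrix is then at most 1 + t M / (α d). -/
theorem log_det_gram_le {α M : ℝ} (hα : 0 < α) (hd : 1 ≤ d) (X : Matrix (Fin t) (Fin d) ℝ)
    (hM : 0 ≤ M) (hX : ∀ i, X i ⬝ᵥ X i ≤ M) :
    Real.log (α⁻¹ • gram α X).det ≤ d * Real.log (1 + t * M / (α * d)) := by
  have hd' : (0 : ℝ) < d := by exact_mod_cast hd
  refine log_det_le_of_trace_le ((gram_posDef hα X).smul (inv_pos.2 hα)) (by positivity) ?_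
  have h : (Xᵀ * X).trace ≤ t * M := by
    rw [Matrix.trace_mul_comm]
    have : ∀ i ∈ Finset.univ, (X * Xᵀ) i i ≤ M := fun i _ => by
      simpa [Matrix.mul_apply, dotProduct] using hX i
    simpa [Matrix.trace] using Finset.sum_le_sum this
  rw [Matrix.trace_smul, gram, Matrix.trace_add, Matrix.trace_smul, Matrix.trace_one]
  simp only [smul_eq_mul, Fintype.card_fin]
  have : (d : ℝ) * (1 + t * M / (α * d)) = α⁻¹ * (t * M + α * d) := by
    field_simp
    ring
  rw [this]
  gcongr

theorem smul_gram_eq {α : ℝ} (hα : 0 < α) (X : Matrix (Fin t) (Fin d) ℝ) :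
    α⁻¹ • gram α X = 1 + α⁻¹ • (Xᵀ * X) := by
  rw [gram, smul_add, smul_smul, inv_mul_cancel₀ hα.ne', one_smul, add_comm]

/-- Sylvester's identity: it trades the t × t determinant in the mixture radius for a d × d one. -/
theorem det_smul_gram_eq {α : ℝ} (hα : 0 < α) (X : Matrix (Fin t) (Fin d) ℝ) :
    (α⁻¹ • gram α X).det = (1 + α⁻¹ • (X * Xᵀ)).det := by
  rw [smul_gram_eq hα, ← Matrix.smul_mul, Matrix.det_one_add_mul_comm, Matrix.mul_smul]

/-- The mixture radius in terms of the ridge loss with parameter `σ² / σ₀²`. -/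
theorem linRadiusSq_eq {σ σ₀ : ℝ} (δ : ℝ) (hσ : 0 < σ) (hσ₀ : 0 < σ₀)
    (θ₀ : EuclideanSpace ℝ (Fin d)) (X : Matrix (Fin t) (Fin d) ℝ) (y : Fin t → ℝ) :
    linRadiusSq σ σ₀ δ θ₀ X y = ridgeMin (σ ^ 2 / σ₀ ^ 2) X (y - X *ᵥ θ₀.ofLp)
      + σ ^ 2 * Real.log ((σ ^ 2 / σ₀ ^ 2)⁻¹ • gram (σ ^ 2 / σ₀ ^ 2) X).det
      + 2 * σ ^ 2 * Real.log (1 / δ) := by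
  have h : (1 / σ ^ 2) • σ₀ ^ 2 • (X * Xᵀ) = (σ ^ 2 / σ₀ ^ 2)⁻¹ • (X * Xᵀ) := by
    rw [smul_smul]
    congr 1
    field_simp
  have hp : 0 < σ ^ 2 / σ₀ ^ 2 := by positivity
  rw [linRadiusSq, mmRadiusSq, h, dotProduct_inv_one_add_mulVec hp, det_smul_gram_eq hp,
    ← ridgeMin_neg, neg_sub]

end LinearAlgebra

/-! ### Exponential supermartingales and Ville's inequality. -/

section Ville

variable {Ω : Type*} {m₀ : MeasurableSpace Ω} {μ : Measure Ω}

theorem setLIntegral_exp_le [IsFiniteMeasure μ] {m : MeasurableSpace Ω} (hm : m ≤ m₀) {σ : ℝ}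
    {ε : Ω → ℝ} (h : CondSubGaussian μ m σ ε) (l : ℝ) {s : Set Ω} (hs : MeasurableSet[m] s) :
    ∫⁻ ω in s, ENNReal.ofReal (Real.exp (l * ε ω - l ^ 2 * σ ^ 2 / 2)) ∂μ ≤ μ s := by
  obtain ⟨hi, hle⟩ := h.2.2 l
  have h1 : ∫⁻ ω in s, ENNReal.ofReal (Real.exp (l * ε ω)) ∂μ
      ≤ ENNReal.ofReal (Real.exp (l ^ 2 * σ ^ 2 / 2)) * μ s := by
    rw [← ofReal_integral_eq_lintegral_ofReal hi.integrableOn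
      (Filter.Eventually.of_forall fun ω => (Real.exp_pos _).le), ← setIntegral_condExp hm hi hs]
    have h2 : ∫ ω in s, (μ[fun ω => Real.exp (l * ε ω)|m]) ω ∂μ
        ≤ ∫ _ in s, Real.exp (l ^ 2 * σ ^ 2 / 2) ∂μ :=
      setIntegral_mono_ae integrable_condExp.integrableOn (integrable_const _).integrableOn hle
    refine (ENNReal.ofReal_le_ofReal h2).trans ?_
    rw [setIntegral_const, smul_eq_mul, mul_comm, ENNReal.ofReal_mul (Real.exp_pos _).le,
      ofReal_measureReal]
  have h3 : ∀ ω, ENNReal.ofReal (Real.exp (l * ε ω - l ^ 2 * σ ^ 2 / 2))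
      = ENNReal.ofReal (Real.exp (-(l ^ 2 * σ ^ 2 / 2))) * ENNReal.ofReal (Real.exp (l * ε ω)) := by
    intro ω
    rw [← ENNReal.ofReal_mul (Real.exp_pos _).le, ← Real.exp_add]
    congr 2
    ring
  simp_rw [h3]
  rw [lintegral_const_mul' _ _ ENNReal.ofReal_ne_top]
  refine (mul_le_mul_right h1 _).trans ?_
  rw [← mul_assoc, ← ENNReal.ofReal_mul (Real.exp_pos _).le, ← Real.exp_add, neg_add_cancel,
    Real.exp_zero, ENNReal.ofReal_one, one_mul]

/-- The set-wise bound says that reweighting μ by the exponential gives a measure dominated by μ on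
the σ-algebra `m`; integrating the `m`-measurable Z against both is then monotone. -/
theorem lintegral_mul_exp_const_le [IsFiniteMeasure μ] {m : MeasurableSpace Ω} (hm : m ≤ m₀)
    {σ : ℝ} {ε : Ω → ℝ} (hε : Measurable[m₀] ε) (h : CondSubGaussian μ m σ ε) (l : ℝ)
    {Z : Ω → ENNReal} (hZ : Measurable[m] Z) :
    ∫⁻ ω, Z ω * ENNReal.ofReal (Real.exp (l * ε ω - l ^ 2 * σ ^ 2 / 2)) ∂μ ≤ ∫⁻ ω, Z ω ∂μ := by
  set g : Ω → ENNReal := fun ω => ENNReal.ofReal (Real.exp (l * ε ω - l ^ 2 * σ ^ 2 / 2)) with hg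
  have hgm : Measurable[m₀] g := by fun_prop
  have hle : (μ.withDensity g).trim hm ≤ μ.trim hm := by
    refine Measure.le_iff.2 fun s hs => ?_
    rw [trim_measurableSet_eq hm hs, trim_measurableSet_eq hm hs, withDensity_apply _ (hm s hs)]
    exact setLIntegral_exp_le hm h l hs
  calc ∫⁻ ω, Z ω * g ω ∂μ = ∫⁻ ω, Z ω ∂(μ.withDensity g) := by
        rw [lintegral_withDensity_eq_lintegral_mul _ hgm (hZ.mono hm le_rfl)]
        simp only [Pi.mul_apply, mul_comm]
    _ = ∫⁻ ω, Z ω ∂((μ.withDensity g).trim hm) := (lintegral_trim hm hZ).symm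
    _ ≤ ∫⁻ ω, Z ω ∂(μ.trim hm) := lintegral_mono' hle le_rfl
    _ = ∫⁻ ω, Z ω ∂μ := lintegral_trim hm hZ

/-- On each fibre of `l` the coefficient is constant, and the indicator of the fibre can be absorbed
into Z. -/
theorem lintegral_mul_exp_simpleFunc_le [IsFiniteMeasure μ] {m : MeasurableSpace Ω} (hm : m ≤ m₀)
    {σ : ℝ} {ε : Ω → ℝ} (hε : Measurable[m₀] ε) (h : CondSubGaussian μ m σ ε)
    (l : @SimpleFunc Ω m ℝ) {Z : Ω → ENNReal} (hZ : Measurable[m] Z) :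
    ∫⁻ ω, Z ω * ENNReal.ofReal (Real.exp (l ω * ε ω - l ω ^ 2 * σ ^ 2 / 2)) ∂μ
      ≤ ∫⁻ ω, Z ω ∂μ := by
  have hdec : ∀ g : Ω → ENNReal, ∀ ω, g ω = ∑ v ∈ l.range, (l ⁻¹' {v}).indicator g ω := by
    intro g ω
    rw [Finset.sum_eq_single (l ω)]
    · simp
    · intro v _ hv
      exact Set.indicator_of_notMem (fun h' => hv h'.symm) _
    · intro h'
      exact absurd (SimpleFunc.mem_range_self l ω) h'
  have hfib : ∀ v, MeasurableSet[m] (l ⁻¹' {v}) := fun v => SimpleFunc.measurableSet_fiber l v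
  have hterm : ∀ v, ∀ ω, (l ⁻¹' {v}).indicator
      (fun ω => Z ω * ENNReal.ofReal (Real.exp (l ω * ε ω - l ω ^ 2 * σ ^ 2 / 2))) ω
      = (l ⁻¹' {v}).indicator Z ω * ENNReal.ofReal (Real.exp (v * ε ω - v ^ 2 * σ ^ 2 / 2)) := by
    intro v ω
    by_cases hv : ω ∈ l ⁻¹' {v}
    · rw [Set.indicator_of_mem hv, Set.indicator_of_mem hv, show l ω = v from hv]
    · rw [Set.indicator_of_notMem hv, Set.indicator_of_notMem hv, zero_mul]
  have hZi : ∀ v, Measurable[m] ((l ⁻¹' {v}).indicator Z) := fun v => hZ.indicator (hfib v)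
  calc ∫⁻ ω, Z ω * ENNReal.ofReal (Real.exp (l ω * ε ω - l ω ^ 2 * σ ^ 2 / 2)) ∂μ
      = ∫⁻ ω, ∑ v ∈ l.range, (l ⁻¹' {v}).indicator Z ω *
          ENNReal.ofReal (Real.exp (v * ε ω - v ^ 2 * σ ^ 2 / 2)) ∂μ := by
        refine lintegral_congr fun ω => ?_
        rw [hdec (fun ω => Z ω * ENNReal.ofReal (Real.exp (l ω * ε ω - l ω ^ 2 * σ ^ 2 / 2))) ω]
        exact Finset.sum_congr rfl fun v _ => hterm v ω
    _ = ∑ v ∈ l.range, ∫⁻ ω, (l ⁻¹' {v}).indicator Z ω *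
          ENNReal.ofReal (Real.exp (v * ε ω - v ^ 2 * σ ^ 2 / 2)) ∂μ := by
        refine lintegral_finsetSum _ fun v _ => ?_
        have := (hZi v).mono hm le_rfl
        fun_prop
    _ ≤ ∑ v ∈ l.range, ∫⁻ ω, (l ⁻¹' {v}).indicator Z ω ∂μ :=
        Finset.sum_le_sum fun v _ => lintegral_mul_exp_const_le hm hε h v (hZi v)
    _ = ∫⁻ ω, Z ω ∂μ := by
        rw [← lintegral_finsetSum _ fun v _ => (hZi v).mono hm le_rfl]
        exact lintegral_congr fun ω => (hdec Z ω).symm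

/-- A conditionally sub-Gaussian variable satisfies the exponential bound with a coefficient
that is itself measurable with respect to the conditioning σ-algebra. -/
theorem lintegral_mul_exp_le [IsFiniteMeasure μ] {m : MeasurableSpace Ω} (hm : m ≤ m₀) {σ : ℝ}
    {ε : Ω → ℝ} (hε : Measurable[m₀] ε) (h : CondSubGaussian μ m σ ε) {l : Ω → ℝ}
    (hl : Measurable[m] l) {Z : Ω → ENNReal} (hZ : Measurable[m] Z) :
    ∫⁻ ω, Z ω * ENNReal.ofReal (Real.exp (l ω * ε ω - l ω ^ 2 * σ ^ 2 / 2)) ∂μ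
      ≤ ∫⁻ ω, Z ω ∂μ := by
  have hls : StronglyMeasurable[m] l := hl.stronglyMeasurable
  have hlim : ∀ ω, Filter.Tendsto (fun n => Z ω * ENNReal.ofReal (Real.exp (hls.approx n ω * ε ω
      - hls.approx n ω ^ 2 * σ ^ 2 / 2))) Filter.atTop
      (nhds (Z ω * ENNReal.ofReal (Real.exp (l ω * ε ω - l ω ^ 2 * σ ^ 2 / 2)))) := by
    intro ω
    have h1 := hls.tendsto_approx ω
    -- Z may be infinite; multiplication by it is continuous here because the limit of the
    -- exponentials is nonzero.
    refine ENNReal.Tendsto.const_mul ?_ (Or.inl ?_)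
    · refine ENNReal.tendsto_ofReal (Real.continuous_exp.continuousAt.tendsto.comp ?_)
      exact (h1.mul_const _).sub (((h1.pow 2).mul_const _).div_const _)
    · exact (ENNReal.ofReal_pos.2 (Real.exp_pos _)).ne'
  calc ∫⁻ ω, Z ω * ENNReal.ofReal (Real.exp (l ω * ε ω - l ω ^ 2 * σ ^ 2 / 2)) ∂μ
      = ∫⁻ ω, Filter.liminf (fun n => Z ω * ENNReal.ofReal (Real.exp (hls.approx n ω * ε ω
          - hls.approx n ω ^ 2 * σ ^ 2 / 2))) Filter.atTop ∂μ :=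
        lintegral_congr fun ω => (hlim ω).liminf_eq.symm
    _ ≤ Filter.liminf (fun n => ∫⁻ ω, Z ω * ENNReal.ofReal (Real.exp (hls.approx n ω * ε ω
          - hls.approx n ω ^ 2 * σ ^ 2 / 2)) ∂μ) Filter.atTop := by
        -- Fatou's lemma suffices, since only an upper bound is wanted.
        refine lintegral_liminf_le fun n => ?_
        have h1 : Measurable[m₀] (hls.approx n) := (hls.approx n).measurable.mono hm le_rfl
        have h2 := hZ.mono hm le_rfl
        fun_prop
    _ ≤ ∫⁻ ω, Z ω ∂μ := by
        refine Filter.liminf_le_of_le (by isBoundedDefault) fun b hb => ?_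
        obtain ⟨n, hn⟩ := hb.exists
        exact hn.trans (lintegral_mul_exp_simpleFunc_le hm hε h (hls.approx n) hZ)

/-- **Ville's inequality**, for extended nonnegative supermartingales. -/
theorem mul_measure_exists_le_lintegral {F : ℕ → MeasurableSpace Ω} (hF : ∀ t, F t ≤ m₀)
    (hFm : Monotone F) {M : ℕ → Ω → ENNReal} (hM : ∀ t, Measurable[F t] (M t))
    (hstep : ∀ t s, MeasurableSet[F t] s → ∫⁻ ω in s, M (t + 1) ω ∂μ ≤ ∫⁻ ω in s, M t ω ∂μ)
    (c : ENNReal) : c * μ {ω | ∃ t, c ≤ M t ω} ≤ ∫⁻ ω, M 0 ω ∂μ := by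
  -- The level `c` has not been reached strictly before time `n`. Hence `A (n + 1)` is already `F
  -- n`-measurable, as `hstep` requires.
  set A : ℕ → Set Ω := fun n => {ω | ∀ t < n, M t ω < c} with hA
  have hmeas : ∀ n, MeasurableSet[F n] (A (n + 1)) := by
    intro n
    have : A (n + 1) = ⋂ t ∈ Finset.range (n + 1), {ω | M t ω < c} := by
      ext ω
      simp [hA]
    rw [this]
    refine Finset.measurableSet_biInter _ fun t ht => ?_
    have ht' : t ≤ n := Nat.lt_succ_iff.1 (Finset.mem_range.1 ht)
    exact (hM t).mono (hFm ht') le_rfl measurableSet_Iio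
  have hmeas' : ∀ n, MeasurableSet (A n) := by
    intro n
    cases n with
    | zero => simp [hA]
    | succ n => exact hF n _ (hmeas n)
  have hanti : ∀ n, A (n + 1) ⊆ A n := fun n ω h t ht => h t (ht.trans (Nat.lt_succ_self n))
  -- The supermartingale stopped on reaching the level: paths in `A n` are still running, the others
  -- have cashed in at least `c`.
  have hind : ∀ n, (∫⁻ ω in A n, M n ω ∂μ) + c * μ (A n)ᶜ ≤ ∫⁻ ω, M 0 ω ∂μ := by
    intro n
    induction n with
    | zero => simp [hA]
    | succ n ih =>
      refine le_trans ?_ ih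
      have h1 : ∫⁻ ω in A n, M n ω ∂μ
          = (∫⁻ ω in A (n + 1), M n ω ∂μ) + ∫⁻ ω in A n \ A (n + 1), M n ω ∂μ := by
        rw [← lintegral_union ((hmeas' n).diff (hmeas' (n + 1))) Set.disjoint_sdiff_right,
          Set.union_sdiff_cancel (hanti n)]
      have h2 : c * μ (A n \ A (n + 1)) ≤ ∫⁻ ω in A n \ A (n + 1), M n ω ∂μ := by
        rw [← setLIntegral_const]
        refine setLIntegral_mono' ((hmeas' n).diff (hmeas' (n + 1))) fun ω hω => ?_
        by_contra hlt
        refine hω.2 fun t ht => ?_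
        rcases Nat.lt_succ_iff_lt_or_eq.1 ht with h | h
        · exact hω.1 t h
        · rw [h]
          exact not_le.1 hlt
      have h3 : μ (A (n + 1))ᶜ ≤ μ (A n \ A (n + 1)) + μ (A n)ᶜ := by
        refine (measure_mono fun ω hω => ?_).trans (measure_union_le _ _)
        by_cases h : ω ∈ A n
        · exact Or.inl ⟨h, hω⟩
        · exact Or.inr h
      calc (∫⁻ ω in A (n + 1), M (n + 1) ω ∂μ) + c * μ (A (n + 1))ᶜ
          ≤ (∫⁻ ω in A (n + 1), M n ω ∂μ) + c * (μ (A n \ A (n + 1)) + μ (A n)ᶜ) :=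
            add_le_add (hstep n _ (hmeas n)) (mul_le_mul_right h3 c)
        _ ≤ (∫⁻ ω in A n, M n ω ∂μ) + c * μ (A n)ᶜ := by
            rw [h1, mul_add, ← add_assoc]
            gcongr
  have hunion : {ω | ∃ t, c ≤ M t ω} = ⋃ n, (A n)ᶜ := by
    ext ω
    simp only [hA, Set.mem_ofPred_eq, Set.mem_iUnion, Set.mem_compl_iff, not_forall, not_lt]
    exact ⟨fun ⟨t, ht⟩ => ⟨t + 1, t, Nat.lt_succ_self t, ht⟩, fun ⟨_, t, _, ht⟩ => ⟨t, ht⟩⟩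
  have hmono : Monotone fun n => (A n)ᶜ :=
    monotone_nat_of_le_succ fun n => Set.compl_subset_compl.2 (hanti n)
  rw [hunion, hmono.measure_iUnion, ENNReal.mul_iSup]
  exact iSup_le fun n => le_add_self.trans (hind n)

end Ville

/-! ### Gaussian integrals, up to the normalising constant. -/

section GaussianIntegral

variable {d : ℕ}

/-- The normalising constant `∫ exp(-‖ξ‖²/2)` of the standard Gaussian density on `ℝ^d`. -/
noncomputable def gaussConst (d : ℕ) : ENNReal :=
  ∫⁻ ξ : Fin d → ℝ, ENNReal.ofReal (Real.exp (-(ξ ⬝ᵥ ξ) / 2))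

theorem gaussConst_ne_top (d : ℕ) : gaussConst d ≠ ⊤ := by
  have h1 : Integrable fun ξ : Fin d → ℝ => ∏ i, Real.exp (-(1 / 2) * ξ i ^ 2) :=
    Integrable.fintype_prod fun _ => integrable_exp_neg_mul_sq (by norm_num)
  have h2 : (fun ξ : Fin d → ℝ => Real.exp (-(ξ ⬝ᵥ ξ) / 2))
      = fun ξ : Fin d → ℝ => ∏ i, Real.exp (-(1 / 2) * ξ i ^ 2) := by
    ext ξ
    rw [← Real.exp_sum, ← Finset.mul_sum, dotProduct]
    congr 1
    simp only [← sq]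
    ring
  rw [← h2] at h1
  rw [gaussConst, ← ofReal_integral_eq_lintegral_ofReal h1
    (Filter.Eventually.of_forall fun ω => (Real.exp_pos _).le)]
  exact ENNReal.ofReal_ne_top

theorem gaussConst_ne_zero (d : ℕ) : gaussConst d ≠ 0 := by
  rw [gaussConst, Ne, lintegral_eq_zero_iff (by unfold dotProduct; fun_prop)]
  intro h
  obtain ⟨ξ, hξ⟩ := h.exists
  exact (ENNReal.ofReal_pos.2 (Real.exp_pos (-(ξ ⬝ᵥ ξ) / 2))).ne' hξ

-- Translate by `b`, write A = SᵀS and substitute Sξ: the Jacobian factor |det S|⁻¹ is the inverse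
-- square root of det A.
open scoped MatrixOrder in
theorem lintegral_gaussian {A : Matrix (Fin d) (Fin d) ℝ} (hA : A.PosDef) (b : Fin d → ℝ) :
    ∫⁻ ξ : Fin d → ℝ, ENNReal.ofReal (Real.exp (-((ξ - b) ⬝ᵥ (A *ᵥ (ξ - b))) / 2))
      = ENNReal.ofReal (√A.det)⁻¹ * gaussConst d := by
  obtain ⟨S, hS⟩ := CStarAlgebra.nonneg_iff_eq_star_mul_self.mp hA.posSemidef.nonneg
  rw [Matrix.star_eq_conjTranspose, Matrix.conjTranspose_eq_transpose_of_trivial] at hS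
  have hdet : A.det = S.det ^ 2 := by rw [hS, Matrix.det_mul, Matrix.det_transpose, sq]
  have hS0 : S.det ≠ 0 := by
    intro h
    have := hA.det_pos
    rw [hdet, h] at this
    simp at this
  rw [lintegral_sub_right_eq_self
    (fun ξ : Fin d → ℝ => ENNReal.ofReal (Real.exp (-(ξ ⬝ᵥ (A *ᵥ ξ)) / 2)))]
  have hq : ∀ ξ : Fin d → ℝ, ξ ⬝ᵥ (A *ᵥ ξ) = (S *ᵥ ξ) ⬝ᵥ (S *ᵥ ξ) := by
    intro ξ
    rw [hS, ← Matrix.mulVec_mulVec, dotProduct_comm, transpose_mulVec_dotProduct]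
  have hmap := Real.map_matrix_volume_pi_eq_smul_volume_pi hS0
  have hg : Measurable fun ξ : Fin d → ℝ => ENNReal.ofReal (Real.exp (-(ξ ⬝ᵥ ξ) / 2)) := by
    unfold dotProduct
    fun_prop
  have hSm : Measurable (Matrix.toLin' S) := (Matrix.toLin' S).continuous_of_finiteDimensional.measurable
  calc ∫⁻ ξ : Fin d → ℝ, ENNReal.ofReal (Real.exp (-(ξ ⬝ᵥ (A *ᵥ ξ)) / 2))
      = ∫⁻ ξ : Fin d → ℝ, ENNReal.ofReal (Real.exp (-(ξ ⬝ᵥ ξ) / 2))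
          ∂(Measure.map (Matrix.toLin' S) volume) := by
        rw [lintegral_map hg hSm]
        simp only [hq, Matrix.toLin'_apply]
    _ = ENNReal.ofReal (√A.det)⁻¹ * gaussConst d := by
        rw [hmap, lintegral_smul_measure, hdet, Real.sqrt_sq_eq_abs, abs_inv, gaussConst,
          smul_eq_mul]

end GaussianIntegral

/-! ### The Gaussian mixture of likelihood ratios. -/

section Mixture

variable {d : ℕ}

/-- Logarithm of the likelihood ratio of the parameters `θ* + h + s ξ` and `θ*` after `t`
rounds with features `f` and noise `e`. -/
noncomputable def logRatio (σ s : ℝ) (h : Fin d → ℝ) (f : ℕ → Fin d → ℝ) (e : ℕ → ℝ) (t : ℕ)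
    (ξ : Fin d → ℝ) : ℝ :=
  ∑ k ∈ Finset.range t,
    (f k ⬝ᵥ (h + s • ξ) / σ ^ 2 * e k - (f k ⬝ᵥ (h + s • ξ) / σ ^ 2) ^ 2 * σ ^ 2 / 2)

/-- The likelihood ratio averaged over a standard Gaussian `ξ`, up to normalisation. -/
noncomputable def mixture (σ s : ℝ) (h : Fin d → ℝ) (f : ℕ → Fin d → ℝ) (e : ℕ → ℝ) (t : ℕ) :
    ENNReal :=
  ∫⁻ ξ : Fin d → ℝ, ENNReal.ofReal (Real.exp (-(ξ ⬝ᵥ ξ) / 2))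
    * ENNReal.ofReal (Real.exp (logRatio σ s h f e t ξ))

theorem measurable_mixture_integrand {Ω : Type*} [MeasurableSpace Ω] (σ s : ℝ) (h : Fin d → ℝ)
    {f : ℕ → Ω → Fin d → ℝ} {e : ℕ → Ω → ℝ} {t : ℕ} (hf : ∀ k < t, Measurable (f k))
    (he : ∀ k < t, Measurable (e k)) :
    Measurable fun p : Ω × (Fin d → ℝ) => ENNReal.ofReal (Real.exp (-(p.2 ⬝ᵥ p.2) / 2))
      * ENNReal.ofReal (Real.exp
        (logRatio σ s h (fun k => f k p.1) (fun k => e k p.1) t p.2)) := by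
  refine Measurable.mul (by unfold dotProduct; fun_prop)
    (Real.measurable_exp.comp (Finset.measurable_fun_sum _ fun k hk => ?_)).ennreal_ofReal
  have h1 := he k (Finset.mem_range.1 hk)
  have h2 := hf k (Finset.mem_range.1 hk)
  unfold dotProduct
  simp only [Pi.add_apply, Pi.smul_apply]
  fun_prop

theorem measurable_mixture_integrand_right {Ω : Type*} [MeasurableSpace Ω] (σ s : ℝ)
    (h : Fin d → ℝ) {f : ℕ → Ω → Fin d → ℝ} {e : ℕ → Ω → ℝ} {t : ℕ}
    (hf : ∀ k < t, Measurable (f k)) (he : ∀ k < t, Measurable (e k)) (ξ : Fin d → ℝ) :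
    Measurable fun ω => ENNReal.ofReal (Real.exp (-(ξ ⬝ᵥ ξ) / 2))
      * ENNReal.ofReal (Real.exp (logRatio σ s h (fun k => f k ω) (fun k => e k ω) t ξ)) := by
  simpa only [Function.comp_def] using
    (measurable_mixture_integrand σ s h hf he).comp (measurable_prodMk_right (y := ξ))

theorem measurable_dotProduct_div {Ω : Type*} [MeasurableSpace Ω] {f : Ω → Fin d → ℝ}
    (hf : Measurable f) (v : Fin d → ℝ) (c : ℝ) : Measurable fun ω => f ω ⬝ᵥ v / c := by
  unfold dotProduct
  fun_prop

theorem measurable_mixture {Ω : Type*} [MeasurableSpace Ω] (σ s : ℝ) (h : Fin d → ℝ)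
    {f : ℕ → Ω → Fin d → ℝ} {e : ℕ → Ω → ℝ} {t : ℕ} (hf : ∀ k < t, Measurable (f k))
    (he : ∀ k < t, Measurable (e k)) :
    Measurable fun ω => mixture σ s h (fun k => f k ω) (fun k => e k ω) t :=
  (measurable_mixture_integrand σ s h hf he).lintegral_prod_right'

theorem mixture_zero (σ s : ℝ) (h : Fin d → ℝ) (f : ℕ → Fin d → ℝ) (e : ℕ → ℝ) :
    mixture σ s h f e 0 = gaussConst d := by
  simp [mixture, logRatio, gaussConst]

/-- By Tonelli the supermartingale step can be checked for each ξ separately; there the new factor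
has a coefficient known before the noise is drawn. The unnormalised mixture starts at `gaussConst
d`, which cancels from Ville's inequality because it is positive and finite. -/
theorem measure_exists_mixture_ge {Ω : Type*} {m₀ : MeasurableSpace Ω} {μ : Measure Ω}
    [IsProbabilityMeasure μ] {F : ℕ → MeasurableSpace Ω} (hF : ∀ t, F t ≤ m₀)
    (hFm : Monotone F) {σ : ℝ} (s : ℝ) (h : Fin d → ℝ) {f : ℕ → Ω → Fin d → ℝ}
    {e : ℕ → Ω → ℝ} (hf : ∀ k, Measurable[F k] (f k)) (he : ∀ k, Measurable[F (k + 1)] (e k))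
    (hsub : ∀ k, CondSubGaussian μ (F k) σ (e k)) {δ : ℝ} (hδ : 0 < δ) :
    μ {ω | ∃ t, ENNReal.ofReal (1 / δ) * gaussConst d
      ≤ mixture σ s h (fun k => f k ω) (fun k => e k ω) t} ≤ ENNReal.ofReal δ := by
  have hf' : ∀ t, ∀ k < t + 1, Measurable[F t] (f k) := fun t k hk =>
    (hf k).mono (hFm (Nat.lt_succ_iff.1 hk)) le_rfl
  have he' : ∀ t, ∀ k < t, Measurable[F t] (e k) := fun t k hk => (he k).mono (hFm hk) le_rfl
  have hint0 : ∀ t, Measurable fun p : Ω × (Fin d → ℝ) =>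
      ENNReal.ofReal (Real.exp (-(p.2 ⬝ᵥ p.2) / 2)) * ENNReal.ofReal (Real.exp
        (logRatio σ s h (fun k => f k p.1) (fun k => e k p.1) t p.2)) := fun t =>
    measurable_mixture_integrand σ s h (fun k _ => (hf k).mono (hF _) le_rfl)
      (fun k _ => (he k).mono (hF _) le_rfl)
  have hville := mul_measure_exists_le_lintegral (μ := μ) hF hFm
    (M := fun t ω => mixture σ s h (fun k => f k ω) (fun k => e k ω) t)
    (fun t => @measurable_mixture d Ω (F t) σ s h f e t
      (fun k hk => hf' t k (hk.trans (Nat.lt_succ_self t))) (he' t)) ?_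
    (ENNReal.ofReal (1 / δ) * gaussConst d)
  · simp only [mixture_zero, lintegral_const, measure_univ, mul_one] at hville
    have h1 : ENNReal.ofReal δ * (ENNReal.ofReal (1 / δ) * gaussConst d) = gaussConst d := by
      rw [← mul_assoc, ← ENNReal.ofReal_mul hδ.le, mul_one_div_cancel hδ.ne', ENNReal.ofReal_one,
        one_mul]
    have h2 := mul_le_mul_right hville (ENNReal.ofReal δ)
    rw [← mul_assoc, h1, mul_comm] at h2
    exact (ENNReal.mul_le_mul_iff_left (gaussConst_ne_zero d) (gaussConst_ne_top d)).1 h2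
  · intro t A hA
    have hA' := hF t A hA
    simp only [mixture]
    rw [lintegral_lintegral_swap (μ := μ.restrict A) (hint0 (t + 1)).aemeasurable,
      lintegral_lintegral_swap (μ := μ.restrict A) (hint0 t).aemeasurable]
    refine lintegral_mono fun ξ => ?_
    rw [← lintegral_indicator hA', ← lintegral_indicator hA']
    set Z : Ω → ENNReal := fun ω => ENNReal.ofReal (Real.exp (-(ξ ⬝ᵥ ξ) / 2))
      * ENNReal.ofReal (Real.exp (logRatio σ s h (fun k => f k ω) (fun k => e k ω) t ξ)) with hZ
    have hZm : Measurable[F t] Z :=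
      @measurable_mixture_integrand_right d Ω (F t) σ s h f e t
        (fun k hk => hf' t k (hk.trans (Nat.lt_succ_self t))) (he' t) ξ
    have hl : Measurable[F t] fun ω => f t ω ⬝ᵥ (h + s • ξ) / σ ^ 2 :=
      @measurable_dotProduct_div d Ω (F t) _ (hf t) _ _
    refine le_trans (le_of_eq (lintegral_congr fun ω => ?_))
      (lintegral_mul_exp_le (hF t) ((he t).mono (hF _) le_rfl) (hsub t) hl (hZm.indicator hA))
    by_cases hω : ω ∈ A
    · rw [Set.indicator_of_mem hω, Set.indicator_of_mem hω, hZ]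
      simp only
      rw [logRatio, Finset.sum_range_succ, Real.exp_add, ENNReal.ofReal_mul (Real.exp_pos _).le,
        mul_assoc, logRatio]
    · rw [Set.indicator_of_notMem hω, Set.indicator_of_notMem hω, zero_mul]

theorem featureMatrix_mulVec {𝒜 : Type*} (φ : 𝒜 → EuclideanSpace ℝ (Fin d)) (x : ℕ → 𝒜) (t : ℕ)
    (u : Fin d → ℝ) (i : Fin t) : (featureMatrix φ x t *ᵥ u) i = (φ (x i)).ofLp ⬝ᵥ u := rfl

/-- Completing the square in each round: the log-ratio is the drop in squared residual in passing
from θ* to θ* + h + s ξ, divided by 2σ². -/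
theorem logRatio_eq {𝒜 : Type*} {σ : ℝ} (hσ : 0 < σ) (s : ℝ) (h : Fin d → ℝ)
    (φ : 𝒜 → EuclideanSpace ℝ (Fin d)) (x : ℕ → 𝒜) (e : ℕ → ℝ) (t : ℕ) (ξ : Fin d → ℝ) :
    logRatio σ s h (fun k => (φ (x k)).ofLp) e t ξ
      = (rewardVector e t ⬝ᵥ rewardVector e t
        - (featureMatrix φ x t *ᵥ (h + s • ξ) - rewardVector e t)
          ⬝ᵥ (featureMatrix φ x t *ᵥ (h + s • ξ) - rewardVector e t)) / (2 * σ ^ 2) := by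
  have hdot : ∀ u v : Fin t → ℝ, u ⬝ᵥ v = ∑ i, u i * v i := fun _ _ => rfl
  rw [hdot, hdot]
  simp only [Pi.sub_apply, featureMatrix_mulVec, rewardVector]
  rw [← Finset.sum_sub_distrib, Finset.sum_div,
    Fin.sum_univ_eq_sum_range (fun k => (e k * e k - ((φ (x k)).ofLp ⬝ᵥ (h + s • ξ) - e k)
      * ((φ (x k)).ofLp ⬝ᵥ (h + s • ξ) - e k)) / (2 * σ ^ 2)), logRatio]
  refine Finset.sum_congr rfl fun k _ => ?_
  field_simp
  ring

theorem mixture_eq {𝒜 : Type*} {σ s : ℝ} (hσ : 0 < σ) (hs : 0 < s) (h : Fin d → ℝ)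
    (φ : 𝒜 → EuclideanSpace ℝ (Fin d)) (x : ℕ → 𝒜) (e : ℕ → ℝ) (t : ℕ) :
    mixture σ s h (fun k => (φ (x k)).ofLp) e t
      = ENNReal.ofReal (Real.exp ((rewardVector e t ⬝ᵥ rewardVector e t
          - ridgeMin (σ ^ 2 / s ^ 2) (featureMatrix φ x t)
            (rewardVector e t - featureMatrix φ x t *ᵥ h)) / (2 * σ ^ 2))
          * (√((σ ^ 2 / s ^ 2)⁻¹ • gram (σ ^ 2 / s ^ 2) (featureMatrix φ x t)).det)⁻¹)
        * gaussConst d := by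
  set X := featureMatrix φ x t
  set ev := rewardVector e t
  -- This choice makes the ridge penalty on s ξ, divided by 2σ², equal to the prior exponent ‖ξ‖²/2;
  -- the integrand is then a Gaussian in ξ centred at `b`.
  set lam := σ ^ 2 / s ^ 2 with hlam
  have hlam0 : 0 < lam := by positivity
  set w := ev - X *ᵥ h
  set b := s⁻¹ • ridge lam X w with hb
  have key : ∀ ξ : Fin d → ℝ, ENNReal.ofReal (Real.exp (-(ξ ⬝ᵥ ξ) / 2))
      * ENNReal.ofReal (Real.exp (logRatio σ s h (fun k => (φ (x k)).ofLp) e t ξ))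
      = ENNReal.ofReal (Real.exp ((ev ⬝ᵥ ev - ridgeMin lam X w) / (2 * σ ^ 2)))
        * ENNReal.ofReal (Real.exp
          (-((ξ - b) ⬝ᵥ ((lam⁻¹ • gram lam X) *ᵥ (ξ - b))) / 2)) := by
    intro ξ
    rw [← ENNReal.ofReal_mul (Real.exp_pos _).le, ← ENNReal.ofReal_mul (Real.exp_pos _).le,
      ← Real.exp_add, ← Real.exp_add, logRatio_eq hσ]
    congr 2
    have h1 := ridge_loss_eq hlam0 X w (s • ξ)
    have h2 : X *ᵥ (s • ξ) - w = X *ᵥ (h + s • ξ) - ev := by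
      simp only [w, Matrix.mulVec_add]
      abel
    have h3 : s • ξ - ridge lam X w = s • (ξ - b) := by
      rw [hb, smul_sub, smul_smul, mul_inv_cancel₀ hs.ne', one_smul]
    rw [h2, h3, Matrix.mulVec_smul, smul_dotProduct, dotProduct_smul, smul_dotProduct,
      dotProduct_smul] at h1
    simp only [smul_eq_mul] at h1
    rw [Matrix.smul_mulVec, dotProduct_smul, smul_eq_mul]
    set q := (ξ - b) ⬝ᵥ (gram lam X *ᵥ (ξ - b))
    have h4 : (X *ᵥ (h + s • ξ) - ev) ⬝ᵥ (X *ᵥ (h + s • ξ) - ev)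
        = ridgeMin lam X w + s * (s * q) - lam * (s * (s * ξ ⬝ᵥ ξ)) := by linarith
    rw [h4, hlam]
    field_simp
    ring
  simp only [mixture, key]
  rw [lintegral_const_mul' _ _ ENNReal.ofReal_ne_top,
    lintegral_gaussian ((gram_posDef hlam0 X).smul (inv_pos.2 hlam0)), ← mul_assoc,
    ← ENNReal.ofReal_mul (Real.exp_pos _).le]

/-- The deviation bound that holds as long as the mixture has not reached the level `1 / δ`. -/
theorem noise_sq_le_of_mixture_lt {𝒜 : Type*} {σ s δ : ℝ} (hσ : 0 < σ) (hs : 0 < s) (hδ : 0 < δ)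
    (h : Fin d → ℝ) (φ : 𝒜 → EuclideanSpace ℝ (Fin d)) (x : ℕ → 𝒜) (e : ℕ → ℝ) (t : ℕ)
    (hlt : mixture σ s h (fun k => (φ (x k)).ofLp) e t
      < ENNReal.ofReal (1 / δ) * gaussConst d) :
    rewardVector e t ⬝ᵥ rewardVector e t
      ≤ ridgeMin (σ ^ 2 / s ^ 2) (featureMatrix φ x t)
          (rewardVector e t - featureMatrix φ x t *ᵥ h)
        + σ ^ 2 * Real.log ((σ ^ 2 / s ^ 2)⁻¹ • gram (σ ^ 2 / s ^ 2) (featureMatrix φ x t)).det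
        + 2 * σ ^ 2 * Real.log (1 / δ) := by
  have hlam0 : 0 < σ ^ 2 / s ^ 2 := by positivity
  have hdet := ((gram_posDef hlam0 (featureMatrix φ x t)).smul (inv_pos.2 hlam0)).det_pos
  rw [mixture_eq hσ hs] at hlt
  have h1 := lt_of_mul_lt_mul_right' hlt
  rw [ENNReal.ofReal_lt_ofReal_iff (by positivity)] at h1
  have h2 := Real.log_lt_log (by positivity) h1
  rw [Real.log_mul (Real.exp_pos _).ne' (by positivity), Real.log_exp, Real.log_inv,
    Real.log_sqrt hdet.le] at h2
  rw [← sub_eq_add_neg, sub_lt_iff_lt_add, div_lt_iff₀ (by positivity)] at h2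
  linarith

end Mixture

/-! ### Confidence ellipsoids, radius bounds and the elliptic potential. -/

section Deterministic

variable {d : ℕ}

theorem inner_eq_dotProduct (u v : EuclideanSpace ℝ (Fin d)) :
    inner ℝ u v = u.ofLp ⬝ᵥ v.ofLp := by
  rw [EuclideanSpace.inner_eq_star_dotProduct, star_trivial, dotProduct_comm]

theorem norm_sq_eq_dotProduct (u : EuclideanSpace ℝ (Fin d)) :
    ‖u‖ ^ 2 = u.ofLp ⬝ᵥ u.ofLp := by
  rw [← inner_eq_dotProduct, real_inner_self_eq_norm_sq]

theorem ammRadiusSq_eq (Rsq α B : ℝ) {t : ℕ} (X : Matrix (Fin t) (Fin d) ℝ) (y : Fin t → ℝ) :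
    ammRadiusSq Rsq α B X y = Rsq + α * B ^ 2 - ridgeMin α X y := by
  rw [ammRadiusSq, ridgeMin]
  ring

/-- The confidence set is contained in the ellipsoid of squared radius `ammRadiusSq`. -/
theorem gram_norm_sub_ridge_le {Rsq α B : ℝ} (hα : 0 < α) {t : ℕ} (X : Matrix (Fin t) (Fin d) ℝ)
    (y : Fin t → ℝ) {θ : EuclideanSpace ℝ (Fin d)}
    (h1 : (X *ᵥ θ.ofLp - y) ⬝ᵥ (X *ᵥ θ.ofLp - y) ≤ Rsq) (h2 : ‖θ‖ ≤ B) :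
    (θ.ofLp - ridge α X y) ⬝ᵥ (gram α X *ᵥ (θ.ofLp - ridge α X y)) ≤ ammRadiusSq Rsq α B X y := by
  have h3 := ridge_loss_eq hα X y θ.ofLp
  have h4 : α * ‖θ‖ ^ 2 ≤ α * B ^ 2 := by gcongr
  rw [norm_sq_eq_dotProduct] at h4
  rw [ammRadiusSq_eq]
  linarith

theorem abs_dotProduct_sub_ridge_le {Rsq α B : ℝ} (hα : 0 < α) {t : ℕ}
    (X : Matrix (Fin t) (Fin d) ℝ) (y : Fin t → ℝ) (v : Fin d → ℝ)
    {θ : EuclideanSpace ℝ (Fin d)}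
    (h1 : (X *ᵥ θ.ofLp - y) ⬝ᵥ (X *ᵥ θ.ofLp - y) ≤ Rsq) (h2 : ‖θ‖ ≤ B) :
    |v ⬝ᵥ θ.ofLp - v ⬝ᵥ ridge α X y|
      ≤ √(ammRadiusSq Rsq α B X y) * √(v ⬝ᵥ ((gram α X)⁻¹ *ᵥ v)) := by
  rw [← dotProduct_sub]
  exact dotProduct_le_gram hα X (gram_norm_sub_ridge_le hα X y h1 h2)

theorem mem_confSet_iff {R B : ℝ} {t : ℕ} (X : Matrix (Fin t) (Fin d) ℝ) (y : Fin t → ℝ)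
    (hR : 0 ≤ R) (θ : EuclideanSpace ℝ (Fin d)) :
    θ ∈ confSet √R B X y ↔ (X *ᵥ θ.ofLp - y) ⬝ᵥ (X *ᵥ θ.ofLp - y) ≤ R ∧ ‖θ‖ ≤ B := by
  rw [confSet, Set.mem_ofPred_eq, Real.le_sqrt (norm_nonneg _) hR, norm_sq_eq_dotProduct]

/-- Lower bound for the ridge loss of `X θ + e`. -/
theorem ridgeMin_add_ge {α : ℝ} (hα : 0 < α) {t : ℕ} (X : Matrix (Fin t) (Fin d) ℝ)
    (e : Fin t → ℝ) (θ : EuclideanSpace ℝ (Fin d)) {q : ℝ}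
    (hq : e ⬝ᵥ e - ridgeMin α X e ≤ q) :
    e ⬝ᵥ e - q - 2 * √α * ‖θ‖ * √q ≤ ridgeMin α X (e + X *ᵥ θ.ofLp) := by
  set y := e + X *ᵥ θ.ofLp with hy
  set g := ridge α X y with hg
  set b := ridge α X e with hb
  have h1 := ridge_loss_eq hα X y g
  rw [← hg, sub_self, zero_dotProduct, add_zero] at h1
  -- The residual of g - θ for e is that of g for y, so comparing with `h1` leaves only penalty
  -- terms. They combine to α‖g - b‖² + 2α⟨b, θ⟩, and only the cross term can be negative.
  have h2 := ridge_loss_eq hα X e (g - θ.ofLp)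
  have h3 : X *ᵥ (g - θ.ofLp) - e = X *ᵥ g - y := by
    rw [hy, Matrix.mulVec_sub]
    abel
  rw [h3, ← hb] at h2
  have h4 := dotProduct_gram_mulVec_self_ge (α := α) X (g - θ.ofLp - b)
  have hbq : b ⬝ᵥ (gram α X *ᵥ b) = e ⬝ᵥ e - ridgeMin α X e := by
    rw [hb]
    nth_rw 2 [ridge]
    rw [gram_mulVec_inv hα, dotProduct_comm, transpose_mulVec_dotProduct, ridgeMin, ridge]
    ring
  have h5 : α * (b ⬝ᵥ b) ≤ q := (dotProduct_gram_mulVec_self_ge X b).trans (hbq.le.trans hq)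
  have hbn := norm_sq_eq_dotProduct (WithLp.toLp 2 b)
  have hcs : |inner ℝ (WithLp.toLp 2 b) θ| ≤ ‖WithLp.toLp 2 b‖ * ‖θ‖ :=
    abs_real_inner_le_norm _ _
  rw [inner_eq_dotProduct] at hcs
  simp only at hcs hbn
  have h6 : √α * ‖WithLp.toLp 2 b‖ ≤ √q := by
    apply Real.le_sqrt_of_sq_le
    rw [mul_pow, Real.sq_sqrt hα.le, hbn]
    exact h5
  have h7 : α * |b ⬝ᵥ θ.ofLp| ≤ √α * ‖θ‖ * √q := by
    calc α * |b ⬝ᵥ θ.ofLp| ≤ α * (‖WithLp.toLp 2 b‖ * ‖θ‖) := by gcongr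
      _ = √α * ‖θ‖ * (√α * ‖WithLp.toLp 2 b‖) := by
        nth_rw 1 [← Real.mul_self_sqrt hα.le]
        ring
      _ ≤ √α * ‖θ‖ * √q := by gcongr
  have h8 := neg_abs_le (b ⬝ᵥ θ.ofLp)
  have h9 : 0 ≤ α * ((g - b) ⬝ᵥ (g - b)) := mul_nonneg hα.le (dotProduct_self_nonneg' _)
  have h10 := mul_le_mul_of_nonneg_left h8 hα.le
  simp only [sub_dotProduct, dotProduct_sub] at h2 h4 h9 h1
  rw [dotProduct_comm θ.ofLp b, dotProduct_comm θ.ofLp g, dotProduct_comm b g] at *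
  nlinarith

theorem featureMatrix_row_le {𝒜 : Type*} {φ : 𝒜 → EuclideanSpace ℝ (Fin d)} {x : ℕ → 𝒜} {L : ℝ}
    (hx : ∀ k, ‖φ (x k)‖ ≤ L) (t : ℕ) (i : Fin t) :
    featureMatrix φ x t i ⬝ᵥ featureMatrix φ x t i ≤ L ^ 2 := by
  change (φ (x i)).ofLp ⬝ᵥ (φ (x i)).ofLp ≤ L ^ 2
  rw [← norm_sq_eq_dotProduct]
  gcongr
  exact hx i

/-- The radius of AMM-UCB is bounded by `uAMMSq`, given the self-normalised noise bound. -/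
theorem ammRadiusSq_le_uAMMSq {𝒜 : Type*} {φ : 𝒜 → EuclideanSpace ℝ (Fin d)} {x : ℕ → 𝒜}
    {σ σ₀ B L α δ : ℝ} (hσ : 0 < σ) (hσ₀ : 0 < σ₀) (hα : 0 < α) (hd : 1 ≤ d)
    (θs θ₀ : EuclideanSpace ℝ (Fin d)) (hx : ∀ k, ‖φ (x k)‖ ≤ L) (t : ℕ) (y e : Fin t → ℝ)
    (he : y = e + featureMatrix φ x t *ᵥ θs.ofLp)
    (hnoise : e ⬝ᵥ e ≤ ridgeMin α (featureMatrix φ x t) e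
      + σ ^ 2 * Real.log (α⁻¹ • gram α (featureMatrix φ x t)).det
      + 2 * σ ^ 2 * Real.log (1 / δ)) :
    ammRadiusSq (linRadiusSq σ σ₀ δ θ₀ (featureMatrix φ x t) y) α B (featureMatrix φ x t) y
      ≤ uAMMSq σ σ₀ B L α δ ‖θs - θ₀‖ ‖θs‖ d t := by
  set X := featureMatrix φ x t
  have hlam : 0 < σ ^ 2 / σ₀ ^ 2 := by positivity
  have hdp : (0 : ℝ) < d := by exact_mod_cast hd
  have hrow := featureMatrix_row_le hx t
  have hld1 := log_det_gram_le hα hd X (sq_nonneg L) hrow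
  have hld0 := log_det_gram_le hlam hd X (sq_nonneg L) hrow
  have harg : (t : ℝ) * L ^ 2 / (σ ^ 2 / σ₀ ^ 2 * d) = t * σ₀ ^ 2 * L ^ 2 / (σ ^ 2 * d) := by
    field_simp
  rw [harg] at hld0
  have hm1 := mul_le_mul_of_nonneg_left hld1 (sq_nonneg σ)
  have hm0 := mul_le_mul_of_nonneg_left hld0 (sq_nonneg σ)
  have hq := ridgeMin_add_ge hα X e θs
    (q := σ ^ 2 * d * Real.log (1 + t * L ^ 2 / (α * d)) + 2 * σ ^ 2 * Real.log (1 / δ))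
    (by linarith)
  rw [← he] at hq
  -- The competitor θ* - θ₀ leaves residual -e, so the ridge minimum is at most ‖e‖² + (σ²/σ₀²)‖θ* -
  -- θ₀‖².
  have hmin := ridgeMin_le hlam X (y - X *ᵥ θ₀.ofLp) (θs - θ₀).ofLp
  have hres : X *ᵥ (θs - θ₀).ofLp - (y - X *ᵥ θ₀.ofLp) = -e := by
    rw [he, WithLp.ofLp_sub, Matrix.mulVec_sub]
    abel
  rw [hres, neg_dotProduct, dotProduct_neg, neg_neg, ← norm_sq_eq_dotProduct (θs - θ₀)] at hmin
  rw [ammRadiusSq_eq, linRadiusSq_eq δ hσ hσ₀, uAMMSq]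
  -- The summand σ² d of `uAMMSq` is pure slack in this estimate.
  have hpos : 0 ≤ σ ^ 2 * (d : ℝ) := by positivity
  linarith

theorem uAMMSq_mono {σ σ₀ B L α δ D N : ℝ} (hα : 0 < α) (hN : 0 ≤ N) (d : ℕ) {t t' : ℝ}
    (ht : 0 ≤ t) (htt : t ≤ t') :
    uAMMSq σ σ₀ B L α δ D N d t ≤ uAMMSq σ σ₀ B L α δ D N d t' := by
  have h1 : 0 ≤ t * σ₀ ^ 2 * L ^ 2 / (σ ^ 2 * d) := by positivity
  have h2 : 0 ≤ t * L ^ 2 / (α * d) := by positivity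
  rw [uAMMSq, uAMMSq]
  gcongr

theorem gram_featureMatrix_succ {𝒜 : Type*} (φ : 𝒜 → EuclideanSpace ℝ (Fin d)) (x : ℕ → 𝒜)
    (α : ℝ) (t : ℕ) :
    gram α (featureMatrix φ x (t + 1)) = gram α (featureMatrix φ x t)
      + Matrix.replicateCol Unit (φ (x t)).ofLp * Matrix.replicateRow Unit (φ (x t)).ofLp := by
  ext i j
  simp [gram, featureMatrix, Matrix.mul_apply, Fin.sum_univ_castSucc]
  ring

/-- Matrix determinant lemma for a rank-one update; it makes the sum of log(1 + w) in the elliptic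
potential lemma telescope. -/
theorem det_gram_succ {𝒜 : Type*} (φ : 𝒜 → EuclideanSpace ℝ (Fin d)) (x : ℕ → 𝒜)
    {α : ℝ} (hα : 0 < α) (t : ℕ) :
    (α⁻¹ • gram α (featureMatrix φ x (t + 1))).det = (α⁻¹ • gram α (featureMatrix φ x t)).det
      * (1 + (φ (x t)).ofLp ⬝ᵥ ((gram α (featureMatrix φ x t))⁻¹ *ᵥ (φ (x t)).ofLp)) := by
  rw [gram_featureMatrix_succ, Matrix.det_smul, Matrix.det_smul,
    Matrix.det_add_replicateCol_mul_replicateRow (gram_isUnit_det hα _), mul_assoc]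
  congr 3
  rw [Matrix.det_unique, Matrix.add_apply, Matrix.one_apply_eq, Matrix.mul_assoc,
    Matrix.mul_apply]
  congr 1

/-- On [0, 1] the concave function log(1 + w) lies above its chord; this is the source of the factor
1/√(ln 2). -/
theorem min_one_mul_log_two_le {w : ℝ} (hw : 0 ≤ w) :
    min 1 w * Real.log 2 ≤ Real.log (1 + w) := by
  rcases le_total 1 w with h | h
  · rw [min_eq_left h, one_mul]
    exact Real.log_le_log (by norm_num) (by linarith)
  · rw [min_eq_right h]
    have := strictConcaveOn_log_Ioi.concaveOn.2 (x := 1) (y := 2) (by simp) (by simp)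
      (sub_nonneg.2 h) hw (by ring)
    simp only [smul_eq_mul, Real.log_one, mul_zero, zero_add] at this
    refine this.trans (le_of_eq ?_)
    congr 1
    ring

/-- The squared norm of the current feature vector in the inverse Gram matrix. -/
noncomputable def width {𝒜 : Type*} (φ : 𝒜 → EuclideanSpace ℝ (Fin d)) (x : ℕ → 𝒜) (α : ℝ)
    (t : ℕ) : ℝ :=
  (φ (x t)).ofLp ⬝ᵥ ((gram α (featureMatrix φ x t))⁻¹ *ᵥ (φ (x t)).ofLp)

theorem width_nonneg {𝒜 : Type*} (φ : 𝒜 → EuclideanSpace ℝ (Fin d)) (x : ℕ → 𝒜) {α : ℝ}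
    (hα : 0 < α) (t : ℕ) : 0 ≤ width φ x α t := by
  have := (gram_posDef hα (featureMatrix φ x t)).inv.posSemidef.dotProduct_mulVec_nonneg
    (φ (x t)).ofLp
  rwa [star_trivial] at this

/-- The elliptic potential lemma. -/
theorem sum_min_one_width_le {𝒜 : Type*} {φ : 𝒜 → EuclideanSpace ℝ (Fin d)} {x : ℕ → 𝒜}
    {L α : ℝ} (hα : 0 < α) (hd : 1 ≤ d) (hx : ∀ k, ‖φ (x k)‖ ≤ L) (T : ℕ) :
    (∑ t ∈ Finset.range T, min 1 (width φ x α t)) * Real.log 2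
      ≤ d * Real.log (1 + T * L ^ 2 / (α * d)) := by
  refine le_trans ?_ (log_det_gram_le hα hd (featureMatrix φ x T) (sq_nonneg L)
    (featureMatrix_row_le hx T))
  induction T with
  | zero => simp [smul_gram_eq hα, Subsingleton.elim (featureMatrix φ x 0) 0]
  | succ T ih =>
    have hpos := ((gram_posDef hα (featureMatrix φ x T)).smul (inv_pos.2 hα)).det_pos
    have hw := width_nonneg φ x hα T
    rw [Finset.sum_range_succ, add_mul, det_gram_succ φ x hα,
      Real.log_mul hpos.ne' (by unfold width at hw; positivity)]
    exact add_le_add ih (min_one_mul_log_two_le hw)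

end Deterministic

/-! ### From instantaneous to cumulative regret. -/

section Regret

variable {d : ℕ} {𝒜 : Type*} {φ : 𝒜 → EuclideanSpace ℝ (Fin d)} {x : ℕ → 𝒜}

theorem cumRegret_le_regretBound {σ σ₀ B L C α δ D N : ℝ} (hα : 0 < α) (hC : 0 < C) (hd : 1 ≤ d)
    (hN : 0 ≤ N) {θs : EuclideanSpace ℝ (Fin d)} {S : ℕ → Set 𝒜} {ρ : ℕ → ℝ}
    (hx : ∀ t, x t ∈ S t) (hL : ∀ t, ∀ b ∈ S t, ‖φ b‖ ≤ L)
    (hCb : ∀ t, ∀ b ∈ S t, inner ℝ (φ b) θs ∈ Set.Icc (-C) C)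
    (hρ : ∀ t : ℕ, ρ t ≤ uAMMSq σ σ₀ B L α δ D N d t)
    (hinst : ∀ t, ∀ b ∈ S t,
      inner ℝ (φ b) θs - inner ℝ (φ (x t)) θs ≤ 2 * √(ρ t) * √(width φ x α t))
    {T : ℕ} (hT : 1 ≤ T) :
    cumRegret θs φ S x T ≤ regretBound σ σ₀ B L C α δ D N d T := by
  set m := max C √(uAMMSq σ σ₀ B L α δ D N d ((T : ℝ) - 1)) with hm
  have hm0 : 0 ≤ m := hC.le.trans (le_max_left _ _)
  have hlog2 : 0 < Real.log 2 := Real.log_pos (by norm_num)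
  have hT1 : (1 : ℝ) ≤ T := by exact_mod_cast hT
  have hterm : ∀ t ∈ Finset.range T,
      sSup ((fun b => inner ℝ (φ b) θs) '' S t) - inner ℝ (φ (x t)) θs
        ≤ 2 * m * √(min 1 (width φ x α t)) := by
    intro t ht
    -- The action with index t relies on t observations, so among the first T rounds the largest
    -- radius bound is the one at T - 1.
    have htT : (t : ℝ) ≤ T - 1 := by
      have : (t : ℝ) + 1 ≤ T := by exact_mod_cast Finset.mem_range.1 ht
      linarith
    rw [sub_le_iff_le_add]
    refine csSup_le (Set.Nonempty.image _ ⟨x t, hx t⟩) ?_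
    rintro _ ⟨b, hb, rfl⟩
    rw [← sub_le_iff_le_add]
    -- A wide action is charged the trivial regret 2C, a narrow one the confidence bound.
    rcases le_total 1 (width φ x α t) with h | h
    · rw [min_eq_left h, Real.sqrt_one, mul_one]
      have h1 := (hCb t b hb).2
      have h2 := (hCb t _ (hx t)).1
      have h3 : C ≤ m := le_max_left _ _
      simp only
      linarith
    · rw [min_eq_right h]
      refine (hinst t b hb).trans ?_
      have : √(ρ t) ≤ m := (Real.sqrt_le_sqrt ((hρ t).trans
        (uAMMSq_mono hα hN d (Nat.cast_nonneg t) htT))).trans (le_max_right _ _)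
      gcongr
  set s := ∑ t ∈ Finset.range T, min 1 (width φ x α t) with hs
  have hsum : ∑ t ∈ Finset.range T, √(min 1 (width φ x α t)) ≤ √(T * s) := by
    apply Real.le_sqrt_of_sq_le
    refine (sq_sum_le_card_mul_sum_sq (s := Finset.range T)).trans (le_of_eq ?_)
    rw [Finset.card_range, hs]
    congr 1
    exact Finset.sum_congr rfl fun t _ =>
      Real.sq_sqrt (le_min zero_le_one (width_nonneg φ x hα t))
  have hpot := sum_min_one_width_le hα hd (fun k => hL k _ (hx k)) T
  rw [← hs, mul_comm (T : ℝ) (L ^ 2)] at hpot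
  calc cumRegret θs φ S x T ≤ ∑ t ∈ Finset.range T, 2 * m * √(min 1 (width φ x α t)) :=
        Finset.sum_le_sum hterm
    _ ≤ 2 * m * √(T * s) := by
        rw [← Finset.mul_sum]
        gcongr
    _ ≤ 2 * m * √(d * T * Real.log (1 + L ^ 2 * T / (α * d)) / Real.log 2) := by
        gcongr
        rw [le_div_iff₀ hlog2, mul_assoc, mul_comm (d : ℝ) T, mul_assoc]
        gcongr
    _ = regretBound σ σ₀ B L C α δ D N d T := by
        rw [regretBound, ← hm, Real.sqrt_div' _ hlog2.le]
        ring

/-- A maximiser of `UCB_Θ` has small instantaneous regret when `θ*` lies in `Θ`. -/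
theorem regret_le_of_ucb_le {Rsq α B : ℝ} (hα : 0 < α) {t : ℕ} {X : Matrix (Fin t) (Fin d) ℝ}
    {y : Fin t → ℝ} {θs u v : EuclideanSpace ℝ (Fin d)}
    (h1 : (X *ᵥ θs.ofLp - y) ⬝ᵥ (X *ᵥ θs.ofLp - y) ≤ Rsq) (h2 : ‖θs‖ ≤ B)
    (huv : ucb (confSet √Rsq B X y) u ≤ ucb (confSet √Rsq B X y) v) :
    inner ℝ u θs - inner ℝ v θs
      ≤ 2 * √(ammRadiusSq Rsq α B X y) * √(v.ofLp ⬝ᵥ ((gram α X)⁻¹ *ᵥ v.ofLp)) := by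
  have hR : 0 ≤ Rsq := (dotProduct_self_nonneg' _).trans h1
  have hmem : θs ∈ confSet √Rsq B X y := (mem_confSet_iff X y hR θs).2 ⟨h1, h2⟩
  have hbdd : BddAbove ((fun θ => inner ℝ u θ) '' confSet √Rsq B X y) := by
    refine ⟨‖u‖ * B, ?_⟩
    rintro _ ⟨θ, hθ, rfl⟩
    exact (real_inner_le_norm u θ).trans (mul_le_mul_of_nonneg_left hθ.2 (norm_nonneg u))
  have hu : inner ℝ u θs ≤ ucb (confSet √Rsq B X y) u := le_csSup hbdd ⟨θs, hmem, rfl⟩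
  have hθs := abs_le.1 (abs_dotProduct_sub_ridge_le hα X y v.ofLp h1 h2)
  have hv : ucb (confSet √Rsq B X y) v ≤ v.ofLp ⬝ᵥ ridge α X y
      + √(ammRadiusSq Rsq α B X y) * √(v.ofLp ⬝ᵥ ((gram α X)⁻¹ *ᵥ v.ofLp)) := by
    refine csSup_le (Set.Nonempty.image _ ⟨θs, hmem⟩) ?_
    rintro _ ⟨θ, hθ, rfl⟩
    obtain ⟨h3, h4⟩ := (mem_confSet_iff X y hR θ).1 hθ
    have := abs_le.1 (abs_dotProduct_sub_ridge_le hα X y v.ofLp h3 h4)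
    simp only [inner_eq_dotProduct]
    linarith
  rw [inner_eq_dotProduct v]
  linarith

/-- A maximiser of `AUCB` has small instantaneous regret when `θ*` lies in the confidence set. -/
theorem regret_le_of_aucb_le {Rsq α B : ℝ} (hα : 0 < α) {t : ℕ} {X : Matrix (Fin t) (Fin d) ℝ}
    {y : Fin t → ℝ} {θs u v : EuclideanSpace ℝ (Fin d)}
    (h1 : (X *ᵥ θs.ofLp - y) ⬝ᵥ (X *ᵥ θs.ofLp - y) ≤ Rsq) (h2 : ‖θs‖ ≤ B)
    (huv : aucb Rsq α B X y u ≤ aucb Rsq α B X y v) :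
    inner ℝ u θs - inner ℝ v θs
      ≤ 2 * √(ammRadiusSq Rsq α B X y) * √(v.ofLp ⬝ᵥ ((gram α X)⁻¹ *ᵥ v.ofLp)) := by
  have hu := abs_le.1 (abs_dotProduct_sub_ridge_le hα X y u.ofLp h1 h2)
  have hv := abs_le.1 (abs_dotProduct_sub_ridge_le hα X y v.ofLp h1 h2)
  rw [aucb, aucb] at huv
  rw [inner_eq_dotProduct, inner_eq_dotProduct]
  linarith

end Regret

/-! ### The rate d √T log T. -/

section Growth

theorem log_one_add_le_mul_log {c z T : ℝ} (hc : 0 ≤ c) (hz : 0 ≤ z) (hT : 2 ≤ T)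
    (hzT : z ≤ c * T) :
    Real.log (1 + z) ≤ (Real.log (1 + c) / Real.log 2 + 1) * Real.log T := by
  have h2 : 0 < Real.log 2 := Real.log_pos (by norm_num)
  have h3 : Real.log 2 ≤ Real.log T := Real.log_le_log (by norm_num) hT
  have h4 : 0 ≤ Real.log (1 + c) := Real.log_nonneg (by linarith)
  calc Real.log (1 + z) ≤ Real.log ((1 + c) * T) :=
        Real.log_le_log (by linarith) (by nlinarith)
    _ = Real.log (1 + c) + Real.log T := Real.log_mul (by linarith) (by linarith)
    _ ≤ Real.log (1 + c) / Real.log 2 * Real.log T + Real.log T := by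
        gcongr
        rw [div_mul_eq_mul_div, le_div_iff₀ h2]
        gcongr
    _ = _ := by ring

theorem sqrt_le_one_add {w z : ℝ} (hw : 0 ≤ w) (hzw : z ≤ w) : √z ≤ 1 + w := by
  rcases le_total z 0 with hz | hz
  · rw [Real.sqrt_eq_zero_of_nonpos hz]
    linarith
  · have h1 := Real.sq_sqrt hz
    nlinarith [sq_nonneg (√z - 1), Real.sqrt_nonneg z]

/-- Everything is measured against P = d log T / log 2, which is at least d and hence at least 1.
Both U² and the last logarithmic factor are O(P), so the product of the two square roots is O(P √T).
-/
theorem exists_regretBound_le (σ σ₀ B L C α δ D : ℝ) (hσ : 0 < σ) (hσ₀ : 0 < σ₀) (hC : 0 < C)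
    (hα : 0 < α) (hδ : 0 < δ) (hδ' : δ ≤ 1) :
    ∃ K : ℝ, 0 < K ∧ ∀ (d : ℕ), 1 ≤ d → ∀ D' N : ℝ, 0 ≤ D' → D' ≤ D → 0 ≤ N → N ≤ B →
      ∀ T : ℕ, 2 ≤ T →
        regretBound σ σ₀ B L C α δ D' N d T ≤ K * (d * √T * Real.log T) := by
  have hln2 : 0 < Real.log 2 := Real.log_pos (by norm_num)
  have hlδ : 0 ≤ Real.log (1 / δ) := Real.log_nonneg (by rwa [le_div_iff₀ hδ, one_mul])
  set k₀ := (Real.log (1 + σ₀ ^ 2 * L ^ 2 / σ ^ 2) / Real.log 2 + 1) * Real.log 2 with hk₀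
  set k₁ := (Real.log (1 + L ^ 2 / α) / Real.log 2 + 1) * Real.log 2 with hk₁
  have hc₀ : 0 ≤ σ₀ ^ 2 * L ^ 2 / σ ^ 2 := by positivity
  have hc₁ : 0 ≤ L ^ 2 / α := by positivity
  have hlc₀ : 0 ≤ Real.log (1 + σ₀ ^ 2 * L ^ 2 / σ ^ 2) := Real.log_nonneg (by linarith)
  have hlc₁ : 0 ≤ Real.log (1 + L ^ 2 / α) := Real.log_nonneg (by linarith)
  have hk₀0 : 0 < k₀ := by positivity
  have hk₁0 : 0 < k₁ := by positivity
  set l := Real.log (1 / δ) with hl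
  set K₂ := σ ^ 2 + σ ^ 2 / σ₀ ^ 2 * D ^ 2 + σ ^ 2 * k₀ + α * B ^ 2 + 4 * σ ^ 2 * l + σ ^ 2 * k₁
    + 2 * √α * |B| * (1 + (σ ^ 2 * k₁ + 2 * σ ^ 2 * l)) + C ^ 2 with hK₂
  have hK₂0 : 0 < K₂ := by positivity
  refine ⟨2 / √(Real.log 2) * √K₂ * √k₁ / Real.log 2, by positivity, ?_⟩
  intro d hd D' N hD' hDD hN hNB T hT
  have hd1 : (1 : ℝ) ≤ d := by exact_mod_cast hd
  have hT2 : (2 : ℝ) ≤ T := by exact_mod_cast hT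
  have hlT : Real.log 2 ≤ Real.log T := Real.log_le_log (by norm_num) hT2
  set P := d * Real.log T / Real.log 2 with hP
  have hdP : (d : ℝ) ≤ P := by
    rw [hP, le_div_iff₀ hln2]
    gcongr
  have hP1 : 1 ≤ P := hd1.trans hdP
  have hbound : ∀ c z : ℝ, 0 ≤ c → 0 ≤ z → z ≤ c * T →
      d * Real.log (1 + z) ≤ (Real.log (1 + c) / Real.log 2 + 1) * Real.log 2 * P := by
    intro c z hc hz hzT
    have h1 := log_one_add_le_mul_log hc hz hT2 hzT
    calc d * Real.log (1 + z)
        ≤ d * ((Real.log (1 + c) / Real.log 2 + 1) * Real.log T) := by gcongr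
      _ = _ := by
        rw [hP]
        field_simp
  have hcP : ∀ c : ℝ, 0 ≤ c → c ≤ c * P := fun c hc => le_mul_of_one_le_right hc hP1
  have hT1 : (0 : ℝ) ≤ T - 1 := by linarith
  have hdiv : ∀ q : ℝ, 0 ≤ q → ∀ c : ℝ, 0 < c → q / (c * d) ≤ q / c := fun q hq c hc =>
    div_le_div_of_nonneg_left hq hc (le_mul_of_one_le_right hc.le hd1)
  have hb0 : d * Real.log (1 + ((T : ℝ) - 1) * σ₀ ^ 2 * L ^ 2 / (σ ^ 2 * d)) ≤ k₀ * P := by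
    refine hbound _ _ hc₀ (by positivity) ((hdiv _ (by positivity) _ (by positivity)).trans ?_)
    rw [div_mul_eq_mul_div]
    refine div_le_div_of_nonneg_right ?_ (by positivity)
    linarith [mul_nonneg (sq_nonneg σ₀) (sq_nonneg L)]
  have hb1 : d * Real.log (1 + ((T : ℝ) - 1) * L ^ 2 / (α * d)) ≤ k₁ * P := by
    refine hbound _ _ hc₁ (by positivity) ((hdiv _ (by positivity) _ hα).trans ?_)
    rw [div_mul_eq_mul_div]
    refine div_le_div_of_nonneg_right ?_ hα.le
    linarith [sq_nonneg L]
  have hb2 : d * Real.log (1 + L ^ 2 * T / (α * d)) ≤ k₁ * P := by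
    refine hbound _ _ hc₁ (by positivity) ((hdiv _ (by positivity) _ hα).trans ?_)
    rw [div_mul_eq_mul_div]
  have hU : uAMMSq σ σ₀ B L α δ D' N d ((T : ℝ) - 1) ≤ K₂ * P := by
    set z := σ ^ 2 * d * Real.log (1 + ((T : ℝ) - 1) * L ^ 2 / (α * d)) + 2 * σ ^ 2 * l with hz
    have hz1 : z ≤ (σ ^ 2 * k₁ + 2 * σ ^ 2 * l) * P := by
      have h1 := mul_le_mul_of_nonneg_left hb1 (sq_nonneg σ)
      have h2 := hcP (2 * σ ^ 2 * l) (by positivity)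
      linarith
    -- Bounding the root linearly is wasteful but keeps the term O(P).
    have hz2 : √z ≤ (1 + (σ ^ 2 * k₁ + 2 * σ ^ 2 * l)) * P := by
      have := sqrt_le_one_add (by positivity) hz1
      linarith
    have h1 : 2 * √α * N * √z ≤ 2 * √α * |B| * ((1 + (σ ^ 2 * k₁ + 2 * σ ^ 2 * l)) * P) := by
      have := hNB.trans (le_abs_self B)
      gcongr
    have h2 : σ ^ 2 / σ₀ ^ 2 * D' ^ 2 ≤ σ ^ 2 / σ₀ ^ 2 * D ^ 2 := by gcongr
    have h3 := hcP (σ ^ 2 / σ₀ ^ 2 * D ^ 2) (by positivity)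
    have h4 := hcP (α * B ^ 2) (by positivity)
    have h5 := hcP (4 * σ ^ 2 * l) (by positivity)
    have h6 := mul_le_mul_of_nonneg_left hb0 (sq_nonneg σ)
    have h7 := mul_le_mul_of_nonneg_left hb1 (sq_nonneg σ)
    have h8 := mul_le_mul_of_nonneg_left hdP (sq_nonneg σ)
    have h9 : 0 ≤ C ^ 2 * P := by positivity
    rw [uAMMSq, hK₂]
    linarith
  have hmax : max C √(uAMMSq σ σ₀ B L α δ D' N d ((T : ℝ) - 1)) ≤ √K₂ * √P := by
    rw [← Real.sqrt_mul hK₂0.le]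
    refine max_le (Real.le_sqrt_of_sq_le ?_) (Real.sqrt_le_sqrt hU)
    have h1 : C ^ 2 ≤ K₂ := by
      rw [hK₂]
      exact le_add_of_nonneg_left (by positivity)
    exact h1.trans (le_mul_of_one_le_right hK₂0.le hP1)
  have hlast : √(d * T * Real.log (1 + L ^ 2 * T / (α * d))) ≤ √k₁ * √P * √T := by
    rw [← Real.sqrt_mul hk₁0.le, ← Real.sqrt_mul (by positivity)]
    apply Real.sqrt_le_sqrt
    rw [mul_right_comm]
    gcongr
  calc regretBound σ σ₀ B L C α δ D' N d T
      ≤ 2 / √(Real.log 2) * (√K₂ * √P) * (√k₁ * √P * √T) := by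
        rw [regretBound]
        gcongr
    _ = 2 / √(Real.log 2) * √K₂ * √k₁ * (√P * √P) * √T := by ring
    _ = 2 / √(Real.log 2) * √K₂ * √k₁ / Real.log 2 * (d * √T * Real.log T) := by
        rw [Real.mul_self_sqrt (by positivity), hP]
        ring

end Growth

/-! ### Measurability with respect to the history. -/

section History

variable {Ω 𝒜 : Type*} {m₀ : MeasurableSpace Ω} [m𝒜 : MeasurableSpace 𝒜] {a : ℕ → Ω → 𝒜}
  {r : ℕ → Ω → ℝ}

theorem history_le (ha : ∀ t, Measurable (a t)) (hr : ∀ t, Measurable (r t)) (t : ℕ) :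
    history a r t ≤ m₀ := by
  refine sup_le (iSup₂_le fun i _ => (ha i).comap_le) (iSup₂_le fun i _ => ?_)
  rw [← BorelSpace.measurable_eq]
  exact (hr i).comap_le

theorem history_mono (a : ℕ → Ω → 𝒜) (r : ℕ → Ω → ℝ) : Monotone (history a r) := fun _ _ h =>
  sup_le_sup
    (biSup_mono fun _ hi => Finset.range_subset_range.2 (Nat.succ_le_succ h) hi)
    (biSup_mono fun _ hi => Finset.range_subset_range.2 h hi)

theorem measurable_action_history (a : ℕ → Ω → 𝒜) (r : ℕ → Ω → ℝ) (t : ℕ) :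
    Measurable[history a r t] (a t) := by
  rw [measurable_iff_comap_le]
  exact le_sup_of_le_left (le_iSup₂_of_le t (Finset.self_mem_range_succ t) le_rfl)

theorem measurable_reward_history (a : ℕ → Ω → 𝒜) (r : ℕ → Ω → ℝ) (t : ℕ) :
    Measurable[history a r (t + 1)] (r t) := by
  rw [measurable_iff_comap_le]
  refine le_sup_of_le_right (le_iSup₂_of_le t (Finset.self_mem_range_succ t) ?_)
  rw [← BorelSpace.measurable_eq]

theorem measurable_noise {d : ℕ} {m : MeasurableSpace Ω} {φ : 𝒜 → EuclideanSpace ℝ (Fin d)}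
    (hφ : Measurable φ) (θs : EuclideanSpace ℝ (Fin d)) {t : ℕ} (ha : Measurable (a t))
    (hr : Measurable (r t)) : Measurable (noise θs φ a r t) :=
  hr.sub ((hφ.comp ha).inner_const (c := θs))

end History

/-! ### The two failure events and their probabilities. -/

section Event

variable {Ω 𝒜 : Type*} {d : ℕ} {φ : 𝒜 → EuclideanSpace ℝ (Fin d)} {a : ℕ → Ω → 𝒜}
  {r : ℕ → Ω → ℝ} {σ δ : ℝ} {θs : EuclideanSpace ℝ (Fin d)}

/-- The event that the mixture with shift `h` and scale `s` ever reaches the level `1 / δ`. -/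
def mixtureEvent (φ : 𝒜 → EuclideanSpace ℝ (Fin d)) (a : ℕ → Ω → 𝒜) (r : ℕ → Ω → ℝ)
    (θs : EuclideanSpace ℝ (Fin d)) (σ δ s : ℝ) (h : Fin d → ℝ) : Set Ω :=
  {ω | ∃ t, ENNReal.ofReal (1 / δ) * gaussConst d
    ≤ mixture σ s h (fun k => (φ (a k ω)).ofLp) (fun k => noise θs φ a r k ω) t}

theorem noise_sq_le_of_notMem_mixtureEvent {s : ℝ} (hσ : 0 < σ) (hs : 0 < s) (hδ : 0 < δ)
    {h : Fin d → ℝ} {ω : Ω} (hω : ω ∉ mixtureEvent φ a r θs σ δ s h) (t : ℕ)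
    {X : Matrix (Fin t) (Fin d) ℝ} (hX : X = featureMatrix φ (fun k => a k ω) t)
    {e : Fin t → ℝ} (he : e = rewardVector (fun k => noise θs φ a r k ω) t)
    {l : ℝ} (hl : l = σ ^ 2 / s ^ 2) :
    e ⬝ᵥ e ≤ ridgeMin l X (e - X *ᵥ h) + σ ^ 2 * Real.log (l⁻¹ • gram l X).det
      + 2 * σ ^ 2 * Real.log (1 / δ) := by
  subst hX he hl
  exact noise_sq_le_of_mixture_lt hσ hs hδ h φ (fun k => a k ω) (fun k => noise θs φ a r k ω) t
    (not_le.1 fun h' => hω ⟨t, h'⟩)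

theorem rewardVector_noise (ω : Ω) (t : ℕ) :
    rewardVector (fun k => noise θs φ a r k ω) t
      = rewardVector (fun k => r k ω) t - featureMatrix φ (fun k => a k ω) t *ᵥ θs.ofLp := by
  ext i
  rw [Pi.sub_apply, featureMatrix_mulVec, rewardVector, rewardVector, noise, inner_eq_dotProduct]

theorem cumRegret_le_of_notMem_mixtureEvent {σ₀ B L C α : ℝ} (hσ : 0 < σ) (hσ₀ : 0 < σ₀)
    (hC : 0 < C) (hα : 0 < α) (hδ : 0 < δ) (hd : 1 ≤ d) {θ₀ : EuclideanSpace ℝ (Fin d)}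
    (hB : ‖θs‖ ≤ B) {A : ℕ → Ω → Set 𝒜} (hL : ∀ t ω, ∀ b ∈ A t ω, ‖φ b‖ ≤ L)
    (hCb : ∀ t ω, ∀ b ∈ A t ω, inner ℝ (φ b) θs ∈ Set.Icc (-C) C) {ω : Ω}
    (hrun : IsCMMRun σ σ₀ δ B θ₀ φ (fun t => A t ω) (fun t => a t ω) (fun t => r t ω) ∨
      IsAMMRun σ σ₀ δ B α θ₀ φ (fun t => A t ω) (fun t => a t ω) (fun t => r t ω))
    (h₁ : ω ∉ mixtureEvent φ a r θs σ δ σ₀ (θ₀ - θs).ofLp)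
    (h₂ : ω ∉ mixtureEvent φ a r θs σ δ (σ / √α) 0) {T : ℕ} (hT : 1 ≤ T) :
    cumRegret θs φ (fun t => A t ω) (fun t => a t ω) T
      ≤ regretBound σ σ₀ B L C α δ ‖θs - θ₀‖ ‖θs‖ d T := by
  have hmem : ∀ t, a t ω ∈ A t ω := fun t => hrun.elim (fun h => (h t).1) fun h => (h t).1
  have hconf : ∀ t, (featureMatrix φ (fun k => a k ω) t *ᵥ θs.ofLp - rewardVector (fun k => r k ω) t)
      ⬝ᵥ (featureMatrix φ (fun k => a k ω) t *ᵥ θs.ofLp - rewardVector (fun k => r k ω) t)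
      ≤ linRadiusSq σ σ₀ δ θ₀ (featureMatrix φ (fun k => a k ω) t)
        (rewardVector (fun k => r k ω) t) := by
    intro t
    have h := noise_sq_le_of_notMem_mixtureEvent hσ hσ₀ hδ h₁ t rfl rfl rfl
    rw [rewardVector_noise] at h
    rw [linRadiusSq_eq δ hσ hσ₀, ← neg_sub (rewardVector _ t), neg_dotProduct, dotProduct_neg,
      neg_neg]
    refine h.trans (le_of_eq ?_)
    -- With shift θ₀ - θ*, the vector e - X h is the reward vector minus X θ₀, so the bound is
    -- literally R_MM².
    congr 3
    rw [WithLp.ofLp_sub, Matrix.mulVec_sub]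
    abel
  -- The prior scale σ/√α is the one whose ridge parameter is α.
  have hscale : α = σ ^ 2 / (σ / √α) ^ 2 := by
    rw [div_pow, Real.sq_sqrt hα.le]
    field_simp
  refine cumRegret_le_regretBound (φ := φ) (x := fun t => a t ω) (S := fun t => A t ω)
    (ρ := fun t => ammRadiusSq (linRadiusSq σ σ₀ δ θ₀ (featureMatrix φ (fun k => a k ω) t)
      (rewardVector (fun k => r k ω) t)) α B (featureMatrix φ (fun k => a k ω) t)
      (rewardVector (fun k => r k ω) t))
    hα hC hd (norm_nonneg _) hmem (fun t => hL t ω) (fun t => hCb t ω) ?_ ?_ hT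
  · intro t
    refine ammRadiusSq_le_uAMMSq hσ hσ₀ hα hd θs θ₀ (fun k => hL k ω _ (hmem k)) t _
      (rewardVector (fun k => noise θs φ a r k ω) t) ?_ ?_
    · rw [rewardVector_noise, sub_add_cancel]
    · have h := noise_sq_le_of_notMem_mixtureEvent hσ (by positivity) hδ h₂ t rfl rfl hscale
      rwa [Matrix.mulVec_zero, sub_zero] at h
  · intro t b hb
    rcases hrun with h | h
    · exact regret_le_of_ucb_le hα (hconf t) hB ((h t).2 b hb)
    · exact regret_le_of_aucb_le hα (hconf t) hB ((h t).2 b hb)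

variable [MeasurableSpace 𝒜]

theorem measurable_feature {m : MeasurableSpace Ω} (hφ : Measurable φ) {k : ℕ}
    (ha : Measurable (a k)) : Measurable fun ω => (φ (a k ω)).ofLp :=
  (WithLp.measurable_ofLp 2 _).comp (hφ.comp ha)

variable [MeasurableSpace Ω] {μ : Measure Ω} [IsProbabilityMeasure μ]

theorem measurableSet_mixtureEvent (hφ : Measurable φ) (ha : ∀ t, Measurable (a t))
    (hr : ∀ t, Measurable (r t)) (s : ℝ) (h : Fin d → ℝ) :
    MeasurableSet (mixtureEvent φ a r θs σ δ s h) := by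
  rw [mixtureEvent, Set.ofPred_exists]
  exact MeasurableSet.iUnion fun t => measurableSet_le measurable_const
    (measurable_mixture σ s h (fun k _ => measurable_feature hφ (ha k))
      fun k _ => measurable_noise hφ θs (ha k) (hr k))

theorem measure_mixtureEvent_le (hφ : Measurable φ) (ha : ∀ t, Measurable (a t))
    (hr : ∀ t, Measurable (r t))
    (hsub : ∀ t, CondSubGaussian μ (history a r t) σ (noise θs φ a r t)) (hδ : 0 < δ) (s : ℝ)
    (h : Fin d → ℝ) : μ.real (mixtureEvent φ a r θs σ δ s h) ≤ δ := by
  refine ENNReal.toReal_le_of_le_ofReal hδ.le ?_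
  exact measure_exists_mixture_ge (history_le ha hr) (history_mono a r) s h
    (f := fun k ω => (φ (a k ω)).ofLp) (e := noise θs φ a r)
    (fun k => measurable_feature hφ (measurable_action_history a r k))
    (fun k => measurable_noise hφ θs
      ((measurable_action_history a r k).mono (history_mono a r (Nat.le_succ k)) le_rfl)
      (measurable_reward_history a r k)) hsub hδ

end Event

end LinearBandit

theorem mainTheorem6 (σ σ₀ B L C α δ D : ℝ) (hσ : 0 < σ) (hσ₀ : 0 < σ₀) (hB : 0 < B)
    (hL : 0 < L) (hC : 0 < C) (hα : 0 < α) (hδ : 0 < δ) (hδ' : δ ≤ 1 / 2) :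
    ∃ K : ℝ, 0 < K ∧
      ∀ (d : ℕ), 1 ≤ d →
      ∀ (θs θ₀ : EuclideanSpace ℝ (Fin d)), ‖θs‖ ≤ B → ‖θs - θ₀‖ ≤ D →
        (∀ (Ω 𝒜 : Type*) [MeasurableSpace Ω] [MeasurableSpace 𝒜]
            (μ : Measure Ω) [IsProbabilityMeasure μ]
            (φ : 𝒜 → EuclideanSpace ℝ (Fin d)) (A : ℕ → Ω → Set 𝒜)
            (a : ℕ → Ω → 𝒜) (r : ℕ → Ω → ℝ),
          Measurable φ → (∀ t, Measurable (a t)) → (∀ t, Measurable (r t)) →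
          (∀ t, LinearBandit.CondSubGaussian μ (LinearBandit.history a r t) σ
            (LinearBandit.noise θs φ a r t)) →
          (∀ t ω, ∀ b ∈ A t ω, ‖φ b‖ ≤ L) →
          (∀ t ω, ∀ b ∈ A t ω, inner ℝ (φ b) θs ∈ Set.Icc (-C) C) →
          ((∀ ω, LinearBandit.IsCMMRun σ σ₀ δ B θ₀ φ
              (fun t => A t ω) (fun t => a t ω) (fun t => r t ω)) ∨
            (∀ ω, LinearBandit.IsAMMRun σ σ₀ δ B α θ₀ φ
              (fun t => A t ω) (fun t => a t ω) (fun t => r t ω))) →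
          ∃ E : Set Ω, MeasurableSet E ∧ 1 - 2 * δ ≤ μ.real E ∧
            ∀ ω ∈ E, ∀ T : ℕ, 1 ≤ T →
              LinearBandit.cumRegret θs φ (fun t => A t ω) (fun t => a t ω) T
                ≤ LinearBandit.regretBound σ σ₀ B L C α δ ‖θs - θ₀‖ ‖θs‖ d T) ∧
        ∀ T : ℕ, 2 ≤ T →
          LinearBandit.regretBound σ σ₀ B L C α δ ‖θs - θ₀‖ ‖θs‖ d T
            ≤ K * (d * √T * Real.log T) := by
  obtain ⟨K, hK, hbound⟩ :=
    LinearBandit.exists_regretBound_le σ σ₀ B L C α δ D hσ hσ₀ hC hα hδ (by linarith)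
  refine ⟨K, hK, fun d hd θs θ₀ hθB hθD => ⟨?_, hbound d hd _ _ (norm_nonneg _) hθD
    (norm_nonneg _) hθB⟩⟩
  intro Ω 𝒜 _ _ μ _ φ A a r hφ ha hr hsub hL' hC' hrun
  -- Outside `E₁` the parameter θ* lies in every Θ_t; outside `E₂` the self-normalised noise bound
  -- holds. Neither event depends on T, so the bound is uniform in time.
  set E₁ := LinearBandit.mixtureEvent φ a r θs σ δ σ₀ (θ₀ - θs).ofLp
  set E₂ := LinearBandit.mixtureEvent φ a r θs σ δ (σ / √α) 0
  have hm : MeasurableSet (E₁ ∪ E₂) :=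
    (LinearBandit.measurableSet_mixtureEvent hφ ha hr _ _).union
      (LinearBandit.measurableSet_mixtureEvent hφ ha hr _ _)
  refine ⟨(E₁ ∪ E₂)ᶜ, hm.compl, ?_, fun ω hω T hT => ?_⟩
  · rw [measureReal_compl hm, probReal_univ]
    have h1 : μ.real E₁ ≤ δ := LinearBandit.measure_mixtureEvent_le hφ ha hr hsub hδ _ _
    have h2 : μ.real E₂ ≤ δ := LinearBandit.measure_mixtureEvent_le hφ ha hr hsub hδ _ _
    have h3 : μ.real (E₁ ∪ E₂) ≤ μ.real E₁ + μ.real E₂ := measureReal_union_le _ _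
    linarith
  · exact LinearBandit.cumRegret_le_of_notMem_mixtureEvent hσ hσ₀ hC hα hδ hd hθB hL' hC'
      (hrun.imp (fun h => h ω) fun h => h ω) (fun h => hω (Or.inl h)) (fun h => hω (Or.inr h)) hT
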